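/- Let $\mathbb{F}$ be an algebraically closed field. For a rational matrix $H(\lambda)$ and an integer $k$ put $\operatorname{rev}_k H(\lambda):=\lambda^k H(1/\lambda)$. A square rational matrix $R(\lambda)$ is regular at $0$ if all its entries are defined at $0$ and $\det R(0)\ne 0$, and regular at $\infty$ if $R(1/\lambda)$ is regular at $0$; two rational matrices $H,K$ of the same size are equivalent at $0$ (at $\infty$) if $R_1HR_2=K$ with $R_1,R_2$ regular at $0$ (at $\infty$). Every rational matrix $H$ of normal rank $\rho$ is equivalent at $0$ to $\operatorname{diag}(\lambda^{\nu_1},\ldots,\lambda^{\nu_\rho},0)$ and at $\infty$ to $\operatorname{diag}(\lambda^{-\mu_1},\ldots,\lambda^{-\mu_\rho},0)$, for uniquely determined integers $\nu_1\le\cdots\le\nu_\rho$ and $\mu_1\le\cdots\le\mu_\rho$, where the last $0$ denotes a zero block; these are the invariant orders of $H$ at $0$ and at infinity. If $H$ is a polynomial matrix, its partial multiplicities at $0$ are its nonzero (hence positive) invariant orders at $0$, listed with repetitions. Let $G(\lambda)\in\mathbb{F}(\lambda)^{p\times m}$ have normal rank $r$, let $g$ be an integer, let $n,s\ge 0$ be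 integers, and let $$\mathcal{L}(\lambda)=\begin{bmatrix} A_1\lambda+A_0 & B_1\lambda+B_0\\ -(C_1\lambda+C_0) & D_1\lambda+D_0\end{bmatrix}\in\mathbb{F}[\lambda]^{(n+(p+s))\times(n+(m+s))}$$ be a polynomial matrix with coefficient matrices over $\mathbb{F}$, where $A_1\lambda+A_0$ is $n\times n$ and $\det(A_1\lambda+A_0)\not\equiv 0$ (if $n=0$ the blocks $A,B,C$ are empty). Let $\ell=\deg\mathcal{L}\in\{0,1\}$ (with $\ell=0$ if $\mathcal L=0$), $\operatorname{rev}\mathcal{L}:=\operatorname{rev}_\ell\mathcal{L}$, and $\widehat G(\lambda)=(D_1\lambda+D_0)+(C_1\lambda+C_0)(A_1\lambda+A_0)^{-1}(B_1\lambda+B_0)$. Assume that $\mathcal{L}$ is a linearization of $G$ at $\infty$ of grade $g$, that is: (a) $\operatorname{rev}\mathcal{L}$ is minimal at $0$: the values at $\lambda=0$ of $\operatorname{rev}_\ell\begin{bmatrix}A_1\lambda+A_0\\ C_1\lambda+C_0\end{bmatrix}$ and $\operatorname{rev}_\ell\begin{bmatrix}A_1\lambda+A_0& B_1\lambda+B_0\end{bmatrix}$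 both have rank $n$; (b) there are nonnegative integers $s_1,s_2$ with $s_1-s_2=s$ such that $\operatorname{diag}(\operatorname{rev}_g G,I_{s_1})$ and $\operatorname{diag}(\operatorname{rev}_\ell\widehat G,I_{s_2})$ are equivalent at $0$. Let $e_1\le\cdots\le e_t$ be the partial multiplicities of $\operatorname{rev}_\ell(A_1\lambda+A_0)$ at $0$ and let $\widetilde e_1\le\cdots\le\widetilde e_u$ be the partial multiplicities of $\operatorname{rev}\mathcal{L}$ at $0$. Then $t+u\le r$, and the invariant orders at infinity $q_1\le\cdots\le q_r$ of $G$ are $$(q_1,\ldots,q_r)=(-e_t,-e_{t-1},\ldots,-e_1,\underbrace{0,\ldots,0}_{r-t-u},\widetilde e_1,\ldots,\widetilde e_u)-(g,g,\ldots,g).$$ -/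

import Mathlib

open Polynomial

namespace RationalMatrix

noncomputable section

variable {F : Type*} [Field F]

/-! Rational matrices: values, regularity, local equivalence -/

/-- `R(λ)` is defined at the finite point `a`: no entry (in lowest terms) has a vanishing
denominator at `a`. -/
def DefinedAt {p m : ℕ} (R : Matrix (Fin p) (Fin m) (RatFunc F)) (a : F) : Prop :=
  ∀ i j, (R i j).denom.eval a ≠ 0

/-- The constant matrix `R(a)` (meaningful when `R` is defined at `a`). -/
def evalAt {p m : ℕ} (R : Matrix (Fin p) (Fin m) (RatFunc F)) (a : F) :
    Matrix (Fin p) (Fin m) F :=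
  R.map (RatFunc.eval (RingHom.id F) a)

/-- `R(λ)` is regular (invertible) at the finite point `a`. -/
def RegularAt {p : ℕ} (R : Matrix (Fin p) (Fin p) (RatFunc F)) (a : F) : Prop :=
  DefinedAt R a ∧ (evalAt R a).det ≠ 0

/-- The rational matrix `G(1/λ)`. -/
def substInv {p m : ℕ} (G : Matrix (Fin p) (Fin m) (RatFunc F)) :
    Matrix (Fin p) (Fin m) (RatFunc F) :=
  G.map (RatFunc.eval (RatFunc.C : F →+* RatFunc F) (RatFunc.X)⁻¹)

/-- `R(λ)` is regular at infinity: `R(1/λ)` is regular at `0`. -/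
def RegularAtInfty {p : ℕ} (R : Matrix (Fin p) (Fin p) (RatFunc F)) : Prop :=
  RegularAt (substInv R) 0

/-- Equivalence of rational matrices at the finite point `a`. -/
def EquivalentAt {p m : ℕ} (a : F) (G H : Matrix (Fin p) (Fin m) (RatFunc F)) : Prop :=
  ∃ (R₁ : Matrix (Fin p) (Fin p) (RatFunc F)) (R₂ : Matrix (Fin m) (Fin m) (RatFunc F)),
    RegularAt R₁ a ∧ RegularAt R₂ a ∧ R₁ * G * R₂ = H

/-- Equivalence of rational matrices at infinity. -/
def EquivalentAtInfty {p m : ℕ} (G H : Matrix (Fin p) (Fin m) (RatFunc F)) : Prop :=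
  ∃ (R₁ : Matrix (Fin p) (Fin p) (RatFunc F)) (R₂ : Matrix (Fin m) (Fin m) (RatFunc F)),
    RegularAtInfty R₁ ∧ RegularAtInfty R₂ ∧ R₁ * G * R₂ = H

/-! Local Smith--McMillan forms and invariant orders -/

/-- The `p × m` matrix with leading diagonal entries `x ^ ν₁, …, x ^ νᵣ`, where
`ν = [ν₁, …, νᵣ]`, and all other entries zero. -/
def diagPow (p m : ℕ) (x : RatFunc F) (ν : List ℤ) : Matrix (Fin p) (Fin m) (RatFunc F) :=
  Matrix.of fun i j =>
    if (i : ℕ) = (j : ℕ) then (if h : (i : ℕ) < ν.length then x ^ (ν[(i : ℕ)]) else 0) else 0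

/-- `ν = [ν₁, …, νᵣ]`, with `ν₁ ≤ ⋯ ≤ νᵣ` and `r` the normal rank of `G`, is the list of invariant
orders of `G` at `a`: `G` is equivalent at `a` to `diag((λ - a)^ν₁, …, (λ - a)^νᵣ, 0)`. -/
def IsInvariantOrdersAt {p m : ℕ} (G : Matrix (Fin p) (Fin m) (RatFunc F)) (a : F)
    (ν : List ℤ) : Prop :=
  ν.Pairwise (· ≤ ·) ∧ ν.length = G.rank ∧
    EquivalentAt a G (diagPow p m (RatFunc.X - RatFunc.C a) ν)

/-- `μ = [μ₁, …, μᵣ]`, with `μ₁ ≤ ⋯ ≤ μᵣ` and `r` the normal rank of `G`, is the list of invariant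
orders of `G` at infinity: `G` is equivalent at infinity to
`diag((1/λ)^μ₁, …, (1/λ)^μᵣ, 0)`. -/
def IsInvariantOrdersAtInfty {p m : ℕ} (G : Matrix (Fin p) (Fin m) (RatFunc F))
    (μ : List ℤ) : Prop :=
  μ.Pairwise (· ≤ ·) ∧ μ.length = G.rank ∧
    EquivalentAtInfty G (diagPow p m (RatFunc.X)⁻¹ μ)

/-! Polynomial matrices -/

/-- A polynomial matrix regarded as a rational matrix. -/
def toRat {p m : ℕ} (P : Matrix (Fin p) (Fin m) F[X]) : Matrix (Fin p) (Fin m) (RatFunc F) :=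
  P.map (algebraMap F[X] (RatFunc F))

/-- The partial multiplicities of the polynomial matrix `P` at `a`, in nondecreasing order: its
nonzero invariant orders at `a` (all of them positive, since `P` is polynomial). -/
def IsPartialMultiplicitiesAt {p m : ℕ} (P : Matrix (Fin p) (Fin m) F[X]) (a : F)
    (e : List ℤ) : Prop :=
  ∃ ν : List ℤ, IsInvariantOrdersAt (toRat P) a ν ∧ e = ν.filter (· ≠ 0)

/-- The degree of a polynomial matrix (`0` for the zero matrix). -/
def matDegree {p m : ℕ} (P : Matrix (Fin p) (Fin m) F[X]) : ℕ :=
  Finset.univ.sup fun i => Finset.univ.sup fun j => (P i j).natDegree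

/-- The `g`-reversal `λ^g G(1/λ)` of a rational matrix, `g` any integer. -/
def revRat {p m : ℕ} (g : ℤ) (G : Matrix (Fin p) (Fin m) (RatFunc F)) :
    Matrix (Fin p) (Fin m) (RatFunc F) :=
  (RatFunc.X : RatFunc F) ^ g • substInv G

/-- The `d`-reversal `λ^d P(1/λ)` of a polynomial matrix of degree at most `d`, as a polynomial
matrix: in every entry the coefficients of `λ^k` and `λ^(d-k)` are exchanged. -/
def revPoly {p m : ℕ} (d : ℕ) (P : Matrix (Fin p) (Fin m) F[X]) : Matrix (Fin p) (Fin m) F[X] :=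
  P.map (Polynomial.reflect d)

theorem natDegree_le_matDegree {p m : ℕ} (P : Matrix (Fin p) (Fin m) F[X]) (i : Fin p)
    (j : Fin m) : (P i j).natDegree ≤ matDegree P :=
  le_trans (Finset.le_sup (f := fun j => (P i j).natDegree) (Finset.mem_univ j))
    (Finset.le_sup (f := fun i => Finset.univ.sup fun j => (P i j).natDegree)
      (Finset.mem_univ i))

theorem reflect_subst (d : ℕ) (f : F[X]) (hf : f.natDegree ≤ d) :
    algebraMap F[X] (RatFunc F) f =
      (RatFunc.X : RatFunc F) ^ d * (reflect d f).eval₂ RatFunc.C (RatFunc.X)⁻¹ := by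
  have : Invertible (RatFunc.X : RatFunc F) := invertibleOfNonzero RatFunc.X_ne_zero
  have h := eval₂_reflect_mul_pow (RatFunc.C : F →+* RatFunc F) RatFunc.X d f hf
  rw [invOf_eq_inv] at h
  have h2 : ∀ f : F[X], f.eval₂ (RatFunc.C : F →+* RatFunc F) RatFunc.X =
      algebraMap F[X] (RatFunc F) f := by
    intro f
    induction f using Polynomial.induction_on' with
    | add p q hp hq => rw [eval₂_add, map_add, hp, hq]
    | monomial n a => simp [← C_mul_X_pow_eq_monomial]
  rw [← h2 f, ← h, mul_comm]

/-- The two notions of reversal agree on polynomial matrices of degree at most `d`. -/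
theorem toRat_revPoly {p m : ℕ} (d : ℕ) (P : Matrix (Fin p) (Fin m) F[X])
    (hd : ∀ i j, (P i j).natDegree ≤ d) : toRat (revPoly d P) = revRat (d : ℤ) (toRat P) := by
  ext i j : 2
  have h := reflect_subst d (reflect d (P i j))
    (by simpa [hd i j] using (natDegree_reflect_le (N := d) (p := P i j)))
  simp only [reflect_reflect] at h
  simpa [toRat, revPoly, revRat, substInv, RatFunc.eval] using h

theorem det_revPoly_ne_zero {n : ℕ} (d : ℕ) (A : Matrix (Fin n) (Fin n) F[X])
    (hd : ∀ i j, (A i j).natDegree ≤ d) (hA : A.det ≠ 0) : (revPoly d A).det ≠ 0 := by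
  intro h
  set φ : F[X] →+* RatFunc F := eval₂RingHom RatFunc.C (RatFunc.X)⁻¹ with hφ
  have h1 : toRat A = (RatFunc.X : RatFunc F) ^ d • φ.mapMatrix (revPoly d A) := by
    ext i j : 2
    simpa [toRat, revPoly, hφ] using reflect_subst d (A i j) (hd i j)
  have h2 : (toRat A).det = 0 := by
    rw [h1, Matrix.det_smul, ← RingHom.map_det, h, map_zero, mul_zero]
  have h3 : (toRat A).det = algebraMap F[X] (RatFunc F) A.det :=
    (RingHom.map_det (algebraMap F[X] (RatFunc F)) A).symm
  rw [h3] at h2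
  exact hA ((map_eq_zero_iff _ (RatFunc.algebraMap_injective F)).1 h2)

/-! Polynomial system matrices -/

variable (F) in
/-- A polynomial system matrix `[A B; -C D]` with nonsingular `n × n` state matrix `A` (for
`n = 0` the condition is void, the determinant of the empty matrix being `1`). -/
structure PolynomialSystemMatrix (n q r : ℕ) where
  A : Matrix (Fin n) (Fin n) F[X]
  B : Matrix (Fin n) (Fin r) F[X]
  C : Matrix (Fin q) (Fin n) F[X]
  D : Matrix (Fin q) (Fin r) F[X]
  nonsing : A.det ≠ 0

namespace PolynomialSystemMatrix

variable {n q r : ℕ} (P : PolynomialSystemMatrix F n q r)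

/-- The polynomial matrix `[A B; -C D]`. -/
def toMatrix : Matrix (Fin (n + q)) (Fin (n + r)) F[X] :=
  (Matrix.fromBlocks P.A P.B (-P.C) P.D).reindex finSumFinEquiv finSumFinEquiv

/-- The transfer function matrix `D + C A⁻¹ B`. -/
def transfer : Matrix (Fin q) (Fin r) (RatFunc F) :=
  toRat P.D + toRat P.C * (toRat P.A)⁻¹ * toRat P.B

/-- Minimality at the finite point `a` (automatic for `n = 0`). -/
def MinimalAt (a : F) : Prop :=
  (Matrix.fromRows (P.A.map (Polynomial.eval a)) (P.C.map (Polynomial.eval a))).rank = n ∧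
  (Matrix.fromCols (P.A.map (Polynomial.eval a)) (P.B.map (Polynomial.eval a))).rank = n

/-- The degree of `[A B; -C D]`. -/
def degree : ℕ := matDegree P.toMatrix

theorem natDegree_A_le (i j : Fin n) : (P.A i j).natDegree ≤ P.degree := by
  have h := natDegree_le_matDegree P.toMatrix (Fin.castAdd q i) (Fin.castAdd r j)
  simpa [toMatrix, degree] using h

/-- The reversal `λ^d P(1/λ)`, `d` the degree of `P`, as a polynomial system matrix with the same
block partition. -/
def rev : PolynomialSystemMatrix F n q r where
  A := revPoly P.degree P.A
  B := revPoly P.degree P.B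
  C := revPoly P.degree P.C
  D := revPoly P.degree P.D
  nonsing := det_revPoly_ne_zero _ _ P.natDegree_A_le P.nonsing

theorem rev_toMatrix : P.rev.toMatrix = revPoly P.degree P.toMatrix := by
  ext i j : 2
  refine Fin.addCases (fun i => ?_) (fun i => ?_) i <;>
  refine Fin.addCases (fun j => ?_) (fun j => ?_) j <;>
  simp [toMatrix, rev, revPoly]

end PolynomialSystemMatrix

/-- The pencil `M₁ λ + M₀`. -/
def pencil {p m : ℕ} (M₁ M₀ : Matrix (Fin p) (Fin m) F) : Matrix (Fin p) (Fin m) F[X] :=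
  (X : F[X]) • M₁.map C + M₀.map C

variable (F) in
/-- A linear polynomial system matrix
`[A₁ λ + A₀, B₁ λ + B₀; -(C₁ λ + C₀), D₁ λ + D₀]`, with `A₁ λ + A₀` nonsingular. -/
structure LinearSystemMatrix (n q r : ℕ) where
  A₁ : Matrix (Fin n) (Fin n) F
  A₀ : Matrix (Fin n) (Fin n) F
  B₁ : Matrix (Fin n) (Fin r) F
  B₀ : Matrix (Fin n) (Fin r) F
  C₁ : Matrix (Fin q) (Fin n) F
  C₀ : Matrix (Fin q) (Fin n) F
  D₁ : Matrix (Fin q) (Fin r) F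
  D₀ : Matrix (Fin q) (Fin r) F
  nonsing : (pencil A₁ A₀).det ≠ 0

/-- The underlying polynomial system matrix of a linear polynomial system matrix. -/
def LinearSystemMatrix.toSystem {n q r : ℕ} (L : LinearSystemMatrix F n q r) :
    PolynomialSystemMatrix F n q r where
  A := pencil L.A₁ L.A₀
  B := pencil L.B₁ L.B₀
  C := pencil L.C₁ L.C₀
  D := pencil L.D₁ L.D₀
  nonsing := L.nonsing

/-! Linearizations at infinity -/

/-- `diag(G, I_s)`. -/
def diagOne {p m : ℕ} (G : Matrix (Fin p) (Fin m) (RatFunc F)) (s : ℕ) :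
    Matrix (Fin (p + s)) (Fin (m + s)) (RatFunc F) :=
  (Matrix.fromBlocks G 0 0 (1 : Matrix (Fin s) (Fin s) (RatFunc F))).reindex
    finSumFinEquiv finSumFinEquiv

/-- `L` is a linearization of `G` at infinity of grade `g`, with transfer function matrix `Ĝ` and
`ℓ = deg L`: the reversal of `L` is minimal at `0`, and there are nonnegative integers `s₁, s₂` with
`s₁ - s₂ = q - p = r - m` such that `diag(rev_g G, I_{s₁})` and `diag(rev_ℓ Ĝ, I_{s₂})` are
equivalent at `0`. -/
structure IsLinearizationAtInfty {n p m q r : ℕ} (L : LinearSystemMatrix F n q r)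
    (G : Matrix (Fin p) (Fin m) (RatFunc F)) (g : ℤ) : Prop where
  minimal : L.toSystem.rev.MinimalAt 0
  equivalent : ∃ (s₁ s₂ : ℕ) (hrow : q + s₂ = p + s₁) (hcol : r + s₂ = m + s₁),
    EquivalentAt 0 (diagOne (revRat g G) s₁)
      ((diagOne (revRat (L.toSystem.degree : ℤ) L.toSystem.transfer) s₂).reindex
        (finCongr hrow) (finCongr hcol))

end

end RationalMatrix

open RationalMatrix

/-!
The invariant orders of a rational matrix `H` at a point `a` are counted by linear algebra over the
residue field. Let `O` be the discrete valuation ring of rational functions defined at `a`, with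
uniformizer `ϖ`, and let `V_k(H)` be the space of residues of those vectors `x` over `O` for which
`ϖ ^ k x` lies in the lattice `H O^m` (`leadingSpace`). Its dimension does not change when `H` is
multiplied by matrices regular at `a`, and for a diagonal matrix of powers of `ϖ` it is the number
of exponents `≤ k`. Together with the existence of the local Smith form (`exists_localEquiv_zpowDiag`)
this shows that a nondecreasing list is the list of invariant orders of `H` at `a` exactly when its
counts are the dimensions of the `V_k(H)` (`isInvariantOrdersAt_iff`).

For a system matrix `P = [A B; -C D]` that is minimal at `a`, with transfer function
`T = D + C A⁻¹ B`, the rank conditions become Bézout identities `N₁ A + N₂ C = 1` and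
`A M₁ + B M₂ = 1` over `O`. They give a local form of Rosenbrock's theorem: for `k ≥ 0` the space
`V_k(P)` is an extension of the full space of dimension `n` by `V_k(T)` (`orderCount_system`),
because a vector `y` over `O` with `T y` over `O` automatically has `A⁻¹ B y` over `O`; and for `k < 0`
multiplication by `C(a)` identifies `V_k(A⁻¹)` with `V_k(T)` (`orderCount_transfer`). So the
positive orders of `T` are the partial multiplicities of `P`, and its negative orders are the negatives of
those of `A`.

This is applied at `0` to the reversal of the linearization, whose transfer function is the reversal
of the original one (`rev_transfer`). Adding identity blocks only changes the number of orders `0`,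
so the nonzero invariant orders of `rev_g G` at `0` are known; those of `G` at infinity differ from
the orders of `rev_g G` at `0` by the shift `g` (`isInvariantOrdersAtInfty_iff_revRat`), and the
number of zeros is fixed by the rank.
-/

namespace LocalSmith

open Matrix IsLocalRing

/-! ### Counting in lists -/

section Lists

theorem ncard_getElem_eq_countP {α : Type*} (P : α → Prop) [DecidablePred P] (p : ℕ) (l : List α)
    (hl : l.length ≤ p) :
    {i : Fin p | ∃ h : (i : ℕ) < l.length, P l[(i : ℕ)]}.ncard = l.countP (fun a => P a) := by
  have h1 : {i : Fin p | ∃ h : (i : ℕ) < l.length, P l[(i : ℕ)]} =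
      Fin.castLE hl '' {i : Fin l.length | P (l.get i)} := by
    ext i
    constructor
    · rintro ⟨h, hi⟩
      exact ⟨⟨i, h⟩, hi, rfl⟩
    · rintro ⟨j, hj, rfl⟩
      exact ⟨j.2, hj⟩
  rw [h1, Set.ncard_image_of_injective _ (Fin.castLE_injective hl), Set.ncard_eq_toFinset_card']
  have h2 : (Multiset.map l.get (Finset.univ : Finset (Fin l.length)).val) = (l : Multiset α) := by
    rw [Fin.univ_val_map, List.ofFn_get]
  rw [← Multiset.coe_countP, ← h2, Multiset.countP_map]
  simp [Finset.card_def]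

/-- A nondecreasing list of integers is determined by how many of its terms are `≤ k`, for each
`k`. -/
theorem eq_of_countP_le_eq {l l' : List ℤ} (hl : l.Pairwise (· ≤ ·)) (hl' : l'.Pairwise (· ≤ ·))
    (h : ∀ k : ℤ, l.countP (fun a => a ≤ k) = l'.countP (fun a => a ≤ k)) : l = l' := by
  have key : ∀ (l : List ℤ) (k : ℤ),
      l.countP (fun a => a ≤ k) = l.countP (fun a => a ≤ k - 1) + l.count k := by
    intro l k
    induction l with
    | nil => simp
    | cons a l ih =>
      simp only [List.countP_cons, List.count_cons, ih, decide_eq_true_eq, beq_iff_eq]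
      split_ifs <;> omega
  refine List.Perm.eq_of_pairwise' hl hl' (List.perm_iff_count.2 fun k => ?_)
  have h1 := key l k
  have h2 := key l' k
  rw [h k, h (k - 1)] at h1
  omega

end Lists

/-! ### Vectors over a subring -/

section Vectors

variable {R S μ : Type*} [CommRing R] [CommRing S] (f : R →+* S)

theorem comp_zero : f ∘ (0 : μ → R) = 0 := by ext; simp

theorem comp_add (x y : μ → R) : f ∘ (x + y) = f ∘ x + f ∘ y := by ext; simp

theorem comp_sub (x y : μ → R) : f ∘ (x - y) = f ∘ x - f ∘ y := by ext; simp

theorem comp_smul (c : R) (x : μ → R) : f ∘ (c • x) = f c • (f ∘ x) := by ext; simp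

theorem comp_pow_smul (c : R) (d : ℕ) (x : μ → R) : f ∘ (c ^ d • x) = f c ^ d • (f ∘ x) := by
  rw [comp_smul, map_pow]

theorem comp_mulVec {κ : Type*} [Fintype κ] (M : Matrix μ κ R) (x : κ → R) :
    f ∘ (M *ᵥ x) = M.map f *ᵥ (f ∘ x) := by
  ext i
  exact RingHom.map_mulVec f M x i

end Vectors

variable {O K : Type*} [CommRing O] [Field K] [Algebra O K]
variable {ι κ ι' κ' : Type*} [Fintype ι] [Fintype κ] [Fintype ι'] [Fintype κ']

/-! ### Equivalence over a subring -/

section Equivalence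

variable [DecidableEq ι] [DecidableEq κ] [DecidableEq ι'] [DecidableEq κ']

variable (O) in
/-- Equivalence of matrices over `K` under multiplication on both sides by invertible matrices
over the subring `O`. -/
def LocalEquiv (G H : Matrix ι κ K) : Prop :=
  ∃ (U : Matrix ι ι O) (V : Matrix κ κ O), IsUnit U ∧ IsUnit V ∧
    U.map (algebraMap O K) * G * V.map (algebraMap O K) = H

theorem LocalEquiv.refl (G : Matrix ι κ K) : LocalEquiv O G G :=
  ⟨1, 1, isUnit_one, isUnit_one, by simp⟩

theorem LocalEquiv.symm {G H : Matrix ι κ K} (h : LocalEquiv O G H) : LocalEquiv O H G := by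
  obtain ⟨_, _, ⟨U, rfl⟩, ⟨V, rfl⟩, rfl⟩ := h
  refine ⟨↑U⁻¹, ↑V⁻¹, U⁻¹.isUnit, V⁻¹.isUnit, ?_⟩
  have h1 : (↑U⁻¹ : Matrix ι ι O).map (algebraMap O K) * (U : Matrix ι ι O).map (algebraMap O K)
      = 1 := by
    rw [← Matrix.map_mul, Units.inv_mul]; simp
  have h2 : (V : Matrix κ κ O).map (algebraMap O K) * (↑V⁻¹ : Matrix κ κ O).map (algebraMap O K)
      = 1 := by
    rw [← Matrix.map_mul, Units.mul_inv]; simp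
  rw [Matrix.mul_assoc, Matrix.mul_assoc, h2, Matrix.mul_one, ← Matrix.mul_assoc, h1,
    Matrix.one_mul]

theorem LocalEquiv.trans {G H J : Matrix ι κ K} (h : LocalEquiv O G H) (h' : LocalEquiv O H J) :
    LocalEquiv O G J := by
  obtain ⟨U, V, hU, hV, rfl⟩ := h
  obtain ⟨U', V', hU', hV', rfl⟩ := h'
  exact ⟨U' * U, V * V', hU'.mul hU, hV.mul hV', by simp only [Matrix.map_mul, Matrix.mul_assoc]⟩

/-- Rows and columns may be permuted independently on the two sides. -/
theorem LocalEquiv.of_submatrix {G H : Matrix ι κ K} (e e' : ι' ≃ ι) (f f' : κ' ≃ κ)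
    (h : LocalEquiv O (G.submatrix e f) (H.submatrix e' f')) : LocalEquiv O G H := by
  obtain ⟨U, V, hU, hV, h⟩ := h
  refine ⟨U.submatrix e'.symm e.symm, V.submatrix f.symm f'.symm,
    (isUnit_submatrix_equiv _ _).2 hU, (isUnit_submatrix_equiv _ _).2 hV, ?_⟩
  have h2 := congrArg (fun M => M.submatrix e'.symm f'.symm) h
  simp only [submatrix_submatrix, Equiv.self_comp_symm, submatrix_id_id] at h2
  rw [← h2, ← submatrix_map, ← submatrix_map]
  have hG : G = (G.submatrix e f).submatrix e.symm f.symm := by simp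
  conv_lhs => rw [hG]
  rw [submatrix_mul_equiv, submatrix_mul_equiv]

theorem LocalEquiv.fromBlocks_diagonal {A A' : Matrix ι κ K} {D D' : Matrix ι' κ' K}
    (hA : LocalEquiv O A A') (hD : LocalEquiv O D D') :
    LocalEquiv O (fromBlocks A 0 0 D) (fromBlocks A' 0 0 D') := by
  obtain ⟨U, V, hU, hV, rfl⟩ := hA
  obtain ⟨U', V', hU', hV', rfl⟩ := hD
  exact ⟨fromBlocks U 0 0 U', fromBlocks V 0 0 V', isUnit_fromBlocks_zero₂₁.2 ⟨hU, hU'⟩,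
    isUnit_fromBlocks_zero₂₁.2 ⟨hV, hV'⟩, by simp [fromBlocks_map, fromBlocks_multiply]⟩

/-- Block elimination with a pivot block that divides its row and its column over `O`. -/
theorem LocalEquiv.eliminate (A : Matrix ι κ K) (X : Matrix ι ι' O) (Y : Matrix κ' κ O)
    (D : Matrix ι' κ' K) :
    LocalEquiv O
      (fromBlocks A (X.map (algebraMap O K) * D) (D * Y.map (algebraMap O K)) D)
      (fromBlocks (A - X.map (algebraMap O K) * D * Y.map (algebraMap O K)) 0 0 D) := by
  refine ⟨fromBlocks 1 (-X) 0 1, fromBlocks 1 0 (-Y) 1, by simp, by simp, ?_⟩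
  have hX : (-X).map (algebraMap O K) = -X.map (algebraMap O K) := by ext; simp
  have hY : (-Y).map (algebraMap O K) = -Y.map (algebraMap O K) := by ext; simp
  simp [fromBlocks_map, fromBlocks_multiply, hX, hY, Matrix.mul_assoc, sub_eq_add_neg]

end Equivalence

/-! ### Diagonal matrices of powers -/

section Diagonal

/-- The `p × m` matrix with leading diagonal entries `x ^ ν₁, …, x ^ νᵣ` and zeros elsewhere. -/
def zpowDiag (p m : ℕ) (x : K) (ν : List ℤ) : Matrix (Fin p) (Fin m) K :=
  Matrix.of fun i j =>
    if (i : ℕ) = (j : ℕ) then (if h : (i : ℕ) < ν.length then x ^ (ν[(i : ℕ)]) else 0) else 0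

theorem zpowDiag_mulVec {p m : ℕ} (x : K) {ν : List ℤ} (hm : ν.length ≤ m) (y : Fin m → K)
    (i : Fin p) :
    (zpowDiag p m x ν *ᵥ y) i =
      if h : (i : ℕ) < ν.length then x ^ (ν[(i : ℕ)]) * y ⟨i, h.trans_le hm⟩ else 0 := by
  rw [mulVec, dotProduct]
  split_ifs with h
  · rw [Finset.sum_eq_single ⟨i, h.trans_le hm⟩]
    · simp [zpowDiag, h]
    · intro j _ hj
      have : (i : ℕ) ≠ j := fun h' => hj (Fin.ext h'.symm)
      simp [zpowDiag, this]
    · simp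
  · simp [zpowDiag, h]

theorem rank_zpowDiag {p m : ℕ} {x : K} (hx : x ≠ 0) {ν : List ℤ} (hp : ν.length ≤ p)
    (hm : ν.length ≤ m) : (zpowDiag p m x ν).rank = ν.length := by
  have h1 : LinearMap.range (zpowDiag p m x ν).mulVecLin =
      Pi.spanSubset K {i : Fin p | ∃ h : (i : ℕ) < ν.length, True} := by
    ext v
    simp only [LinearMap.mem_range, mulVecLin_apply, Pi.mem_spanSubset_iff, Set.mem_ofPred_eq,
      exists_prop, and_true]
    constructor
    · rintro ⟨y, rfl⟩ i hi
      rw [zpowDiag_mulVec x hm, dif_neg hi]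
    · intro hv
      refine ⟨fun j => if h : (j : ℕ) < ν.length then
        (x ^ (ν[(j : ℕ)]))⁻¹ * v ⟨j, h.trans_le hp⟩ else 0, ?_⟩
      ext i
      rw [zpowDiag_mulVec x hm]
      split_ifs with h
      · have : x ^ (ν[(i : ℕ)]) ≠ 0 := zpow_ne_zero _ hx
        simp [this]
      · exact (hv i h).symm
  rw [rank, h1, Pi.dim_spanSubset, ncard_getElem_eq_countP (fun _ => True) p ν hp]
  simp

end Diagonal

/-! ### Leading spaces -/

section LeadingSpace

variable [IsLocalRing O]

/-- The space of leading coefficients of order `k` of the lattice `H O^κ`: the residues of the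
vectors `x` over `O` for which `ϖ ^ k x` lies in `H O^κ`. -/
def leadingSpace (ϖ : O) (k : ℤ) (H : Matrix ι κ K) :
    Submodule (ResidueField O) (ι → ResidueField O) where
  carrier := {v | ∃ (x : ι → O) (y : κ → O),
    (algebraMap O K ϖ) ^ k • (algebraMap O K ∘ x) = H *ᵥ (algebraMap O K ∘ y) ∧ residue O ∘ x = v}
  add_mem' := by
    rintro _ _ ⟨x, y, h, rfl⟩ ⟨x', y', h', rfl⟩
    refine ⟨x + x', y + y', ?_, comp_add _ _ _⟩
    rw [comp_add, comp_add, smul_add, h, h', mulVec_add]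
  zero_mem' := ⟨0, 0, by rw [comp_zero, comp_zero, smul_zero, mulVec_zero], comp_zero _⟩
  smul_mem' := by
    rintro c _ ⟨x, y, h, rfl⟩
    obtain ⟨c, rfl⟩ := residue_surjective c
    refine ⟨c • x, c • y, ?_, comp_smul _ _ _⟩
    rw [comp_smul, comp_smul, smul_comm, h, mulVec_smul]

theorem mem_leadingSpace {ι : Type*} {ϖ : O} {k : ℤ} {H : Matrix ι κ K} {v : ι → ResidueField O} :
    v ∈ leadingSpace ϖ k H ↔ ∃ (x : ι → O) (y : κ → O),
      (algebraMap O K ϖ) ^ k • (algebraMap O K ∘ x) = H *ᵥ (algebraMap O K ∘ y) ∧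
        residue O ∘ x = v :=
  Iff.rfl

/-- The number of invariant orders `≤ k` of `H`, as the dimension of the leading space. -/
noncomputable def orderCount (ϖ : O) (k : ℤ) (H : Matrix ι κ K) : ℕ :=
  Module.finrank (ResidueField O) (leadingSpace ϖ k H)

variable [FaithfulSMul O K]

/-- If `U` has a left inverse over `O`, the leading space of `U H W` lies in the image of that of `H`
under the residue of `U`. -/
theorem orderCount_mul_le {ϖ : O} (hϖ : ϖ ≠ 0) (k : ℤ) [DecidableEq ι]
    (U : Matrix ι' ι O) (U' : Matrix ι ι' O) (hU : U' * U = 1) (H : Matrix ι κ K)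
    (W : Matrix κ κ' O) :
    orderCount ϖ k (U.map (algebraMap O K) * H * W.map (algebraMap O K)) ≤ orderCount ϖ k H := by
  classical
  have hinj := FaithfulSMul.algebraMap_injective O K
  have hw : (algebraMap O K ϖ) ^ k ≠ 0 := zpow_ne_zero _ ((map_ne_zero_iff _ hinj).2 hϖ)
  refine le_trans (Submodule.finrank_mono (t :=
    (leadingSpace ϖ k H).map (toLin' (U.map (residue O)))) ?_) (Submodule.finrank_map_le _ _)
  rintro _ ⟨x, y, h, rfl⟩
  have h1 : (algebraMap O K ϖ) ^ k • (algebraMap O K ∘ (U' *ᵥ x)) =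
      H *ᵥ (algebraMap O K ∘ (W *ᵥ y)) := by
    rw [comp_mulVec, comp_mulVec, ← mulVec_smul, h, mulVec_mulVec, mulVec_mulVec,
      ← Matrix.mul_assoc, ← Matrix.mul_assoc, ← Matrix.map_mul, hU]
    simp
  have h2 : U *ᵥ (U' *ᵥ x) = x := by
    have : (algebraMap O K ϖ) ^ k • (algebraMap O K ∘ (U *ᵥ (U' *ᵥ x))) =
        (algebraMap O K ϖ) ^ k • (algebraMap O K ∘ x) := by
      rw [comp_mulVec, ← mulVec_smul, h1, h, comp_mulVec, mulVec_mulVec, mulVec_mulVec,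
        Matrix.mul_assoc]
    exact hinj.comp_left (smul_right_injective _ hw this)
  refine ⟨_, ⟨_, _, h1, rfl⟩, ?_⟩
  rw [toLin'_apply, ← comp_mulVec, h2]

theorem LocalEquiv.orderCount_eq [DecidableEq ι] [DecidableEq κ] {ϖ : O} (hϖ : ϖ ≠ 0) (k : ℤ)
    {G H : Matrix ι κ K} (h : LocalEquiv O G H) : orderCount ϖ k G = orderCount ϖ k H := by
  have key : ∀ {G H : Matrix ι κ K}, LocalEquiv O G H → orderCount ϖ k H ≤ orderCount ϖ k G := by
    rintro G H ⟨_, V, ⟨U, rfl⟩, -, rfl⟩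
    exact orderCount_mul_le hϖ k _ _ U.inv_mul _ _
  exact le_antisymm (key h.symm) (key h)

theorem orderCount_submatrix_le {ϖ : O} (hϖ : ϖ ≠ 0) (k : ℤ) (e : ι' ≃ ι)
    (f : κ' ≃ κ) (H : Matrix ι κ K) : orderCount ϖ k (H.submatrix e f) ≤ orderCount ϖ k H := by
  classical
  have h1 : H.submatrix e f = ((1 : Matrix ι ι O).submatrix e id).map (algebraMap O K) * H *
      ((1 : Matrix κ κ O).submatrix id f).map (algebraMap O K) := by
    rw [← submatrix_map, ← submatrix_map, Matrix.map_one _ (map_zero _) (map_one _),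
      Matrix.map_one _ (map_zero _) (map_one _)]
    ext i j
    simp [Matrix.mul_apply, Matrix.one_apply]
  rw [h1]
  refine orderCount_mul_le hϖ k _ ((1 : Matrix ι ι O).submatrix id e) ?_ _ _
  rw [submatrix_mul_equiv]
  simp

theorem orderCount_submatrix {ϖ : O} (hϖ : ϖ ≠ 0) (k : ℤ) (e : ι' ≃ ι)
    (f : κ' ≃ κ) (H : Matrix ι κ K) : orderCount ϖ k (H.submatrix e f) = orderCount ϖ k H := by
  refine le_antisymm (orderCount_submatrix_le hϖ k e f H) ?_
  simpa using orderCount_submatrix_le hϖ k e.symm f.symm (H.submatrix e f)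

/-- A lattice contained in `ϖ ^ k O^ι` has no invariant orders below `k`. -/
theorem leadingSpace_eq_bot {ι : Type*} {ϖ : O} (hϖ : ϖ ∈ maximalIdeal O) (hϖ0 : ϖ ≠ 0)
    {j k : ℤ} (hjk : j < k) (T : Matrix ι κ O) :
    leadingSpace ϖ j ((algebraMap O K ϖ) ^ k • T.map (algebraMap O K)) = ⊥ := by
  have hinj := FaithfulSMul.algebraMap_injective O K
  have hw : algebraMap O K ϖ ≠ 0 := (map_ne_zero_iff _ hinj).2 hϖ0
  rw [eq_bot_iff]
  rintro _ ⟨x, y, h, rfl⟩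
  obtain ⟨d, hd⟩ : ∃ d : ℕ, k = j + (d + 1 : ℕ) := ⟨(k - j - 1).toNat, by omega⟩
  have h1 : x = ϖ ^ (d + 1) • (T *ᵥ y) := by
    refine hinj.comp_left (smul_right_injective _ (zpow_ne_zero j hw) ?_)
    change _ • _ = _ • (algebraMap O K ∘ _)
    rw [h, comp_pow_smul, comp_mulVec, smul_smul, smul_mulVec, hd, zpow_add₀ hw, zpow_natCast]
  rw [Submodule.mem_bot, h1]
  ext i
  have : residue O ϖ = 0 := (residue_eq_zero_iff _).2 hϖ
  simp [this]

theorem leadingSpace_zpowDiag {ϖ : O} (hϖ : ϖ ∈ maximalIdeal O) (hϖ0 : ϖ ≠ 0) (k : ℤ) {p m : ℕ}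
    {ν : List ℤ} (hp : ν.length ≤ p) (hm : ν.length ≤ m) :
    leadingSpace ϖ k (zpowDiag p m (algebraMap O K ϖ) ν) =
      Pi.spanSubset _ {i : Fin p | ∃ h : (i : ℕ) < ν.length, ν[(i : ℕ)] ≤ k} := by
  have hinj := FaithfulSMul.algebraMap_injective O K
  have hw : algebraMap O K ϖ ≠ 0 := (map_ne_zero_iff _ hinj).2 hϖ0
  have hres : residue O ϖ = 0 := (residue_eq_zero_iff _).2 hϖ
  ext v
  rw [Pi.mem_spanSubset_iff, mem_leadingSpace]
  constructor
  · rintro ⟨x, y, h, rfl⟩ i hi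
    have hi' := congrFun h i
    rw [zpowDiag_mulVec _ hm] at hi'
    simp only [Pi.smul_apply, Function.comp_apply, smul_eq_mul] at hi' ⊢
    split_ifs at hi' with h0
    · have hlt : k < ν[(i : ℕ)] := by
        by_contra hc
        exact hi ⟨h0, not_lt.1 hc⟩
      obtain ⟨d, hd⟩ : ∃ d : ℕ, ν[(i : ℕ)] = k + (d + 1 : ℕ) :=
        ⟨(ν[(i : ℕ)] - k - 1).toNat, by omega⟩
      rw [hd, zpow_add₀ hw, mul_assoc, zpow_natCast, ← map_pow, ← map_mul] at hi'
      rw [hinj (mul_left_cancel₀ (zpow_ne_zero k hw) hi')]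
      simp [hres]
    · have : algebraMap O K (x i) = 0 := by simpa [zpow_ne_zero k hw] using hi'
      rw [(map_eq_zero_iff _ hinj).1 this, map_zero]
  · intro hv
    choose x hx using fun i => residue_surjective (R := O) (v i)
    refine ⟨fun i => if ∃ h : (i : ℕ) < ν.length, ν[(i : ℕ)] ≤ k then x i else 0,
      fun j => if h : (j : ℕ) < ν.length then ϖ ^ (k - ν[(j : ℕ)]).toNat *
        (if ν[(j : ℕ)] ≤ k then x ⟨j, h.trans_le hp⟩ else 0) else 0, ?_, ?_⟩
    · ext i
      rw [zpowDiag_mulVec _ hm]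
      by_cases h0 : (i : ℕ) < ν.length
      · by_cases h1 : ν[(i : ℕ)] ≤ k
        · have : (algebraMap O K ϖ) ^ k = (algebraMap O K ϖ) ^ ν[(i : ℕ)] *
              (algebraMap O K ϖ) ^ (k - ν[(i : ℕ)]).toNat := by
            rw [← zpow_natCast, ← zpow_add₀ hw]
            congr 1
            omega
          simp [h0, h1, this, mul_assoc]
        · simp [h0, h1]
      · simp [h0]
    · ext i
      by_cases h0 : ∃ h : (i : ℕ) < ν.length, ν[(i : ℕ)] ≤ k
      · simp [h0, hx]
      · simp [h0, hv i h0]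

theorem orderCount_zpowDiag {ϖ : O} (hϖ : ϖ ∈ maximalIdeal O) (hϖ0 : ϖ ≠ 0) (k : ℤ) {p m : ℕ}
    {ν : List ℤ} (hp : ν.length ≤ p) (hm : ν.length ≤ m) :
    orderCount ϖ k (zpowDiag p m (algebraMap O K ϖ) ν) = ν.countP (fun a => a ≤ k) := by
  rw [orderCount, leadingSpace_zpowDiag hϖ hϖ0 k hp hm, Pi.dim_spanSubset,
    ncard_getElem_eq_countP (fun a => a ≤ k) p ν hp]

end LeadingSpace

/-! ### Leading spaces of block diagonal matrices -/

section DirectSum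

theorem comp_elim {R S ι κ : Type*} (f : R → S) (x : ι → R) (y : κ → R) :
    f ∘ Sum.elim x y = Sum.elim (f ∘ x) (f ∘ y) := by
  ext (i | i) <;> rfl

theorem smul_elim {ι κ : Type*} (c : K) (x : ι → K) (y : κ → K) :
    c • Sum.elim x y = Sum.elim (c • x) (c • y) := by
  ext (i | i) <;> rfl

theorem elim_eq_elim {α ι κ : Type*} {x x' : ι → α} {y y' : κ → α} :
    Sum.elim x y = Sum.elim x' y' ↔ x = x' ∧ y = y' := by
  constructor
  · intro h
    exact ⟨funext fun i => congrFun h (Sum.inl i), funext fun i => congrFun h (Sum.inr i)⟩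
  · rintro ⟨rfl, rfl⟩; rfl

/-- Rank-nullity for the restriction of the first projection to `W`: `W₁` is its image and `W₂`
is its kernel. -/
theorem finrank_eq_finrank_map_inl_add {k ι ι' : Type*} [Field k] [Fintype ι] [Fintype ι']
    (W : Submodule k (ι ⊕ ι' → k)) (W₁ : Submodule k (ι → k)) (W₂ : Submodule k (ι' → k))
    (h₁ : ∀ v, v ∈ W₁ ↔ ∃ w ∈ W, w ∘ Sum.inl = v)
    (h₂ : ∀ v, v ∈ W₂ ↔ Sum.elim (0 : ι → k) v ∈ W) :
    Module.finrank k W = Module.finrank k W₁ + Module.finrank k W₂ := by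
  let f : (ι ⊕ ι' → k) →ₗ[k] (ι → k) := LinearMap.funLeft k k Sum.inl
  let g : (ι' → k) →ₗ[k] (ι ⊕ ι' → k) :=
    { toFun := fun v => Sum.elim (0 : ι → k) v
      map_add' := fun v w => by ext (i | i) <;> simp
      map_smul' := fun c v => by ext (i | i) <;> simp }
  let h : W₂ →ₗ[k] W := g.restrict fun v hv => (h₂ v).1 hv
  rw [← (f.domRestrict W).finrank_range_add_finrank_ker]
  have e₁ : LinearMap.range (f.domRestrict W) = W₁ := by
    ext v
    rw [h₁]
    simp only [LinearMap.mem_range, LinearMap.domRestrict_apply, Subtype.exists, exists_prop]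
    rfl
  have e₂ : LinearMap.ker (f.domRestrict W) = LinearMap.range h := by
    ext ⟨w, hw⟩
    simp only [LinearMap.mem_ker, LinearMap.domRestrict_apply, LinearMap.mem_range, Subtype.exists]
    constructor
    · intro h0
      have h3 : Sum.elim (0 : ι → k) (w ∘ Sum.inr) = w := by
        ext (i | i)
        · exact (congrFun h0 i).symm
        · rfl
      exact ⟨w ∘ Sum.inr, (h₂ _).2 (h3.symm ▸ hw), Subtype.ext h3⟩
    · rintro ⟨v, hv, h0⟩
      have h3 : Sum.elim (0 : ι → k) v = w := congrArg Subtype.val h0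
      rw [← h3]
      rfl
  have h_inj : Function.Injective h := by
    rintro ⟨v, hv⟩ ⟨v', hv'⟩ h0
    have h3 : Sum.elim (0 : ι → k) v = Sum.elim (0 : ι → k) v' := congrArg Subtype.val h0
    exact Subtype.ext (funext fun i => congrFun h3 (Sum.inr i))
  rw [e₁, e₂, LinearMap.finrank_range_of_inj h_inj]

variable [IsLocalRing O]

theorem orderCount_fromBlocks_diagonal (ϖ : O) (k : ℤ) (G : Matrix ι κ K) (H : Matrix ι' κ' K) :
    orderCount ϖ k (fromBlocks G 0 0 H) = orderCount ϖ k G + orderCount ϖ k H := by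
  refine finrank_eq_finrank_map_inl_add _ _ _ (fun v => ?_) (fun v => ?_)
  · constructor
    · rintro ⟨x, y, h, rfl⟩
      refine ⟨_, ⟨Sum.elim x 0, Sum.elim y 0, ?_, rfl⟩, ?_⟩
      · rw [comp_elim, comp_elim, fromBlocks_mulVec, smul_elim, elim_eq_elim]
        simp [h]
      · rw [Function.comp_assoc, Sum.elim_comp_inl]
    · rintro ⟨_, ⟨x, y, h, rfl⟩, rfl⟩
      refine ⟨x ∘ Sum.inl, y ∘ Sum.inl, ?_, rfl⟩
      rw [fromBlocks_mulVec] at h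
      ext i
      simpa [Function.comp_assoc] using congrFun h (Sum.inl i)
  · constructor
    · rintro ⟨x, y, h, rfl⟩
      refine ⟨Sum.elim 0 x, Sum.elim 0 y, ?_, ?_⟩
      · rw [comp_elim, comp_elim, fromBlocks_mulVec, smul_elim, elim_eq_elim]
        simp [h]
      · rw [comp_elim, elim_eq_elim]
        exact ⟨comp_zero _, rfl⟩
    · rintro ⟨x, y, h, h'⟩
      refine ⟨x ∘ Sum.inr, y ∘ Sum.inr, ?_, ?_⟩
      · rw [fromBlocks_mulVec] at h
        ext i
        simpa [Function.comp_assoc] using congrFun h (Sum.inr i)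
      · rw [← Function.comp_assoc, h', Sum.elim_comp_inr]

variable [FaithfulSMul O K]

theorem orderCount_one {ϖ : O} (hϖ : ϖ ∈ maximalIdeal O) (hϖ0 : ϖ ≠ 0) (k : ℤ) [DecidableEq ι] :
    orderCount ϖ k (1 : Matrix ι ι K) = if 0 ≤ k then Fintype.card ι else 0 := by
  rw [orderCount]
  split_ifs with hk
  · have : leadingSpace ϖ k (1 : Matrix ι ι K) = ⊤ := by
      refine (Submodule.eq_top_iff' (p := leadingSpace ϖ k (1 : Matrix ι ι K))).2 fun v => ?_
      choose x hx using fun i => residue_surjective (R := O) (v i)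
      obtain ⟨d, rfl⟩ := Int.eq_ofNat_of_zero_le hk
      exact ⟨x, ϖ ^ d • x, by ext; simp, funext hx⟩
    rw [this, finrank_top, Module.finrank_fintype_fun_eq_card]
  · have := leadingSpace_eq_bot (K := K) hϖ hϖ0 (not_le.1 hk) (1 : Matrix ι ι O)
    rw [zpow_zero, one_smul, Matrix.map_one _ (map_zero _) (map_one _)] at this
    rw [this, finrank_bot]

end DirectSum

/-! ### System matrices and their transfer functions -/

section Rosenbrock

local notation "φ" => algebraMap O K

variable [IsLocalRing O] [FaithfulSMul O K]
variable {η : Type*} [Fintype η] [DecidableEq η]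

theorem zpow_neg_smul_eq_iff {μ : Type*} {c : K} (hc : c ≠ 0) {d : ℕ} {x y : μ → K} :
    c ^ (-(d : ℤ)) • x = y ↔ x = c ^ d • y := by
  rw [_root_.zpow_neg, zpow_natCast, inv_smul_eq_iff₀ (pow_ne_zero d hc)]

/-- For a system matrix `[A B; -C D]` over `O` with coprime block column `[A; C]` and coprime block
row `[A B]` (both expressed by Bézout identities), the nonnegative invariant orders of the transfer
function are those of the system matrix, apart from `n` additional orders `0`. -/
theorem orderCount_system {ϖ : O} (hϖ0 : ϖ ≠ 0) {k : ℤ} (hk : 0 ≤ k)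
    {A : Matrix η η O} {B : Matrix η κ O} {C : Matrix ι η O} {D : Matrix ι κ O}
    {N₁ : Matrix η η O} {N₂ : Matrix η ι O} (hN : N₁ * A + N₂ * C = 1)
    {M₁ : Matrix η η O} {M₂ : Matrix κ η O} (hM : A * M₁ + B * M₂ = 1) (hA : A.det ≠ 0) :
    orderCount ϖ k ((fromBlocks A B (-C) D).map (algebraMap O K)) =
      Fintype.card η + orderCount ϖ k (D.map (algebraMap O K) +
        C.map (algebraMap O K) * (A.map (algebraMap O K))⁻¹ * B.map (algebraMap O K)) := by
  have hinj := FaithfulSMul.algebraMap_injective O K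
  obtain ⟨d, rfl⟩ := Int.eq_ofNat_of_zero_le hk
  have hw : φ ϖ ≠ 0 := (map_ne_zero_iff _ hinj).2 hϖ0
  have hu : IsUnit (A.map φ).det := by
    rw [← RingHom.mapMatrix_apply, ← RingHom.map_det, isUnit_iff_ne_zero]
    exact (map_ne_zero_iff _ hinj).2 hA
  -- Over `O`, the lattice generated by the transfer function meets `O^ι` in the vectors `v` for
  -- which `(0, v)` lies in the lattice generated by the system matrix.
  have hlat : ∀ (y : κ → O) (v : ι → O), (∃ z : η → O, A *ᵥ z + B *ᵥ y = 0 ∧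
      (-C) *ᵥ z + D *ᵥ y = v) ↔ φ ∘ v = (D.map φ + C.map φ * (A.map φ)⁻¹ * B.map φ) *ᵥ (φ ∘ y) := by
    intro y v
    constructor
    · rintro ⟨z, h1, rfl⟩
      have h2 : A.map φ *ᵥ (φ ∘ z) = -(B.map φ *ᵥ (φ ∘ y)) := by
        rw [← comp_mulVec, ← comp_mulVec, eq_neg_of_add_eq_zero_left h1]
        ext; simp
      have h3 : φ ∘ z = -((A.map φ)⁻¹ *ᵥ (B.map φ *ᵥ (φ ∘ y))) := by
        rw [← mulVec_neg, ← h2, mulVec_mulVec, nonsing_inv_mul _ hu, one_mulVec]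
      have h4 : φ ∘ ((-C) *ᵥ z + D *ᵥ y) = D.map φ *ᵥ (φ ∘ y) - C.map φ *ᵥ (φ ∘ z) := by
        rw [← comp_mulVec, ← comp_mulVec]
        ext; simp [neg_mulVec]; ring
      rw [h4, h3, add_mulVec, mulVec_neg, sub_neg_eq_add, mulVec_mulVec, mulVec_mulVec,
        Matrix.mul_assoc]
    · intro h
      set u : η → K := (A.map φ)⁻¹ *ᵥ (B.map φ *ᵥ (φ ∘ y)) with hu'
      have hAu : A.map φ *ᵥ u = φ ∘ (B *ᵥ y) := by
        rw [hu', mulVec_mulVec, mul_nonsing_inv _ hu, one_mulVec, comp_mulVec]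
      have hCu : C.map φ *ᵥ u = φ ∘ (v - D *ᵥ y) := by
        have : φ ∘ v = φ ∘ (D *ᵥ y) + C.map φ *ᵥ u := by
          rw [h, add_mulVec, comp_mulVec, hu', mulVec_mulVec, mulVec_mulVec, Matrix.mul_assoc]
        ext i
        have := congrFun this i
        simp at this ⊢
        rw [this]; ring
      have hz : u = φ ∘ (N₁ *ᵥ (B *ᵥ y) + N₂ *ᵥ (v - D *ᵥ y)) := by
        have h5 : (N₁.map φ * A.map φ + N₂.map φ * C.map φ) *ᵥ u = u := by
          rw [← Matrix.map_mul, ← Matrix.map_mul, ← Matrix.map_add _ (map_add φ), hN,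
            Matrix.map_one _ (map_zero _) (map_one _), one_mulVec]
        rw [← h5, add_mulVec, ← mulVec_mulVec, ← mulVec_mulVec, hAu, hCu, ← comp_mulVec,
          ← comp_mulVec]
        ext; simp
      set z := N₁ *ᵥ (B *ᵥ y) + N₂ *ᵥ (v - D *ᵥ y)
      rw [hz, ← comp_mulVec] at hAu hCu
      refine ⟨-z, ?_, ?_⟩
      · rw [mulVec_neg, hinj.comp_left hAu, neg_add_cancel]
      · rw [neg_mulVec_neg, hinj.comp_left hCu, sub_add_cancel]
  have hP : ∀ (x : η → O) (y : κ → O) (w : η → O) (v : ι → O),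
      φ ϖ ^ (d : ℤ) • (φ ∘ Sum.elim w v) = (fromBlocks A B (-C) D).map φ *ᵥ (φ ∘ Sum.elim x y) ↔
        A *ᵥ x + B *ᵥ y = ϖ ^ d • w ∧ (-C) *ᵥ x + D *ᵥ y = ϖ ^ d • v := by
    intro x y w v
    rw [zpow_natCast, ← comp_pow_smul, ← comp_mulVec, hinj.comp_left.eq_iff, fromBlocks_mulVec]
    have : ϖ ^ d • Sum.elim w v = Sum.elim (ϖ ^ d • w) (ϖ ^ d • v) := by ext (i | i) <;> rfl
    rw [this, elim_eq_elim]
    simp only [Sum.elim_comp_inl, Sum.elim_comp_inr]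
    exact ⟨fun h => ⟨h.1.symm, h.2.symm⟩, fun h => ⟨h.1.symm, h.2.symm⟩⟩
  -- The Bézout identity for `[A B]` provides preimages of `(w, *)`.
  have hsec : ∀ w : η → O, A *ᵥ (M₁ *ᵥ w) + B *ᵥ (M₂ *ᵥ w) = w := by
    intro w
    rw [mulVec_mulVec, mulVec_mulVec, ← add_mulVec, hM, one_mulVec]
  have htop : Fintype.card η =
      Module.finrank (ResidueField O) (⊤ : Submodule (ResidueField O) (η → ResidueField O)) := by
    rw [finrank_top, Module.finrank_fintype_fun_eq_card]
  rw [htop]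
  refine finrank_eq_finrank_map_inl_add _ _ _ (fun v => ?_) (fun v => ?_)
  · simp only [Submodule.mem_top, true_iff]
    choose w hw using fun i => residue_surjective (R := O) (v i)
    refine ⟨_, ⟨Sum.elim w ((-C) *ᵥ (M₁ *ᵥ w) + D *ᵥ (M₂ *ᵥ w)),
      Sum.elim (ϖ ^ d • (M₁ *ᵥ w)) (ϖ ^ d • (M₂ *ᵥ w)), (hP _ _ _ _).2 ⟨?_, ?_⟩, rfl⟩, ?_⟩
    · rw [mulVec_smul, mulVec_smul, ← smul_add, hsec]
    · rw [mulVec_smul, mulVec_smul, ← smul_add]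
    · rw [Function.comp_assoc, Sum.elim_comp_inl]
      exact funext hw
  · constructor
    · rintro ⟨x, y, h, rfl⟩
      rw [zpow_natCast, ← comp_pow_smul] at h
      obtain ⟨z, h1, h2⟩ := (hlat y (ϖ ^ d • x)).2 h
      refine ⟨Sum.elim 0 x, Sum.elim z y, (hP _ _ _ _).2 ⟨by rw [h1, smul_zero], h2⟩, ?_⟩
      rw [comp_elim, elim_eq_elim]
      exact ⟨comp_zero _, rfl⟩
    · rintro ⟨w, u, h, hv⟩
      obtain ⟨w, x, rfl⟩ : ∃ w₁ w₂, w = Sum.elim w₁ w₂ := ⟨_, _, (Sum.elim_comp_inl_inr w).symm⟩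
      obtain ⟨z, y, rfl⟩ : ∃ w₁ w₂, u = Sum.elim w₁ w₂ := ⟨_, _, (Sum.elim_comp_inl_inr u).symm⟩
      obtain ⟨h1, h2⟩ := (hP _ _ _ _).1 h
      rw [comp_elim, elim_eq_elim] at hv
      obtain ⟨hw0, rfl⟩ := hv
      refine ⟨x - ((-C) *ᵥ (M₁ *ᵥ w) + D *ᵥ (M₂ *ᵥ w)), y - ϖ ^ d • (M₂ *ᵥ w), ?_, ?_⟩
      · rw [zpow_natCast, ← comp_pow_smul, ← hlat]
        refine ⟨z - ϖ ^ d • (M₁ *ᵥ w), ?_, ?_⟩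
        · have := hsec w
          rw [mulVec_sub, mulVec_sub, mulVec_smul, mulVec_smul, sub_add_sub_comm, h1, ← smul_add,
            this, sub_self]
        · rw [mulVec_sub, mulVec_sub, mulVec_smul, mulVec_smul, sub_add_sub_comm, h2, ← smul_add,
            smul_sub]
      · have h3 : residue O ∘ ((-C) *ᵥ (M₁ *ᵥ w) + D *ᵥ (M₂ *ᵥ w)) = 0 := by
          rw [comp_add, comp_mulVec, comp_mulVec, comp_mulVec, comp_mulVec, hw0]
          simp
        rw [comp_sub, h3, sub_zero]

/-- Under the same coprimeness conditions, the negative invariant orders of the transfer function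
are those of the inverse of the state matrix. -/
theorem orderCount_transfer {ϖ : O} (hϖ : ϖ ∈ maximalIdeal O) (hϖ0 : ϖ ≠ 0) {k : ℤ} (hk : k < 0)
    {A : Matrix η η O} {B : Matrix η κ O} {C : Matrix ι η O} {D : Matrix ι κ O}
    {N₁ : Matrix η η O} {N₂ : Matrix η ι O} (hN : N₁ * A + N₂ * C = 1)
    {M₁ : Matrix η η O} {M₂ : Matrix κ η O} (hM : A * M₁ + B * M₂ = 1) (hA : A.det ≠ 0) :
    orderCount ϖ k (D.map (algebraMap O K) +
        C.map (algebraMap O K) * (A.map (algebraMap O K))⁻¹ * B.map (algebraMap O K)) =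
      orderCount ϖ k (A.map (algebraMap O K))⁻¹ := by
  classical
  have hinj := FaithfulSMul.algebraMap_injective O K
  obtain ⟨d, hd, rfl⟩ : ∃ d : ℕ, d ≠ 0 ∧ k = -(d : ℤ) := ⟨(-k).toNat, by omega, by omega⟩
  have hw : φ ϖ ≠ 0 := (map_ne_zero_iff _ hinj).2 hϖ0
  have hu : IsUnit (A.map φ).det := by
    rw [← RingHom.mapMatrix_apply, ← RingHom.map_det, isUnit_iff_ne_zero]
    exact (map_ne_zero_iff _ hinj).2 hA
  have hresd : residue O ϖ ^ d = 0 := by rw [(residue_eq_zero_iff _).2 hϖ, zero_pow hd]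
  have hT : ∀ y : κ → O, (D.map φ + C.map φ * (A.map φ)⁻¹ * B.map φ) *ᵥ (φ ∘ y) =
      φ ∘ (D *ᵥ y) + C.map φ *ᵥ ((A.map φ)⁻¹ *ᵥ (φ ∘ (B *ᵥ y))) := by
    intro y
    rw [add_mulVec, comp_mulVec, comp_mulVec, mulVec_mulVec, mulVec_mulVec, Matrix.mul_assoc]
  refine le_antisymm ?_ ?_
  · refine le_trans (Submodule.finrank_mono (t := (leadingSpace ϖ (-(d : ℤ)) (A.map φ)⁻¹).map
      (toLin' (C.map (residue O)))) ?_) (Submodule.finrank_map_le _ _)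
    rintro _ ⟨x, y, h, rfl⟩
    rw [zpow_neg_smul_eq_iff hw, hT] at h
    set u : η → K := φ ϖ ^ d • ((A.map φ)⁻¹ *ᵥ (φ ∘ (B *ᵥ y))) with hu'
    have hAu : A.map φ *ᵥ u = φ ∘ (ϖ ^ d • (B *ᵥ y)) := by
      rw [hu', mulVec_smul, mulVec_mulVec, mul_nonsing_inv _ hu, one_mulVec, ← comp_pow_smul]
    have hCu : C.map φ *ᵥ u = φ ∘ (x - ϖ ^ d • (D *ᵥ y)) := by
      rw [comp_sub, h, comp_pow_smul, smul_add, hu', mulVec_smul, add_sub_cancel_left]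
    have hz : u = φ ∘ (N₁ *ᵥ (ϖ ^ d • (B *ᵥ y)) + N₂ *ᵥ (x - ϖ ^ d • (D *ᵥ y))) := by
      have h5 : (N₁.map φ * A.map φ + N₂.map φ * C.map φ) *ᵥ u = u := by
        rw [← Matrix.map_mul, ← Matrix.map_mul, ← Matrix.map_add _ (map_add φ), hN,
          Matrix.map_one _ (map_zero _) (map_one _), one_mulVec]
      rw [← h5, add_mulVec, ← mulVec_mulVec, ← mulVec_mulVec, hAu, hCu, ← comp_mulVec,
        ← comp_mulVec, comp_add]
    set z := N₁ *ᵥ (ϖ ^ d • (B *ᵥ y)) + N₂ *ᵥ (x - ϖ ^ d • (D *ᵥ y))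
    refine ⟨residue O ∘ z, ⟨z, B *ᵥ y, ?_, rfl⟩, ?_⟩
    · rw [zpow_neg_smul_eq_iff hw, ← hz]
    · rw [hz, ← comp_mulVec] at hCu
      rw [toLin'_apply, ← comp_mulVec, hinj.comp_left hCu, sub_eq_add_neg, comp_add, ← smul_neg,
        comp_pow_smul, hresd, zero_smul, add_zero]
  · refine le_trans (Submodule.finrank_mono (t := (leadingSpace ϖ (-(d : ℤ))
      (D.map φ + C.map φ * (A.map φ)⁻¹ * B.map φ)).map
      (toLin' (N₂.map (residue O)))) ?_) (Submodule.finrank_map_le _ _)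
    rintro _ ⟨x, y, h, rfl⟩
    rw [zpow_neg_smul_eq_iff hw] at h
    have hAx : A *ᵥ x = ϖ ^ d • y := by
      refine hinj.comp_left (?_ : φ ∘ _ = φ ∘ _)
      rw [comp_mulVec, h, mulVec_smul, mulVec_mulVec, mul_nonsing_inv _ hu, one_mulVec,
        ← comp_pow_smul]
    -- Split `y` by the Bézout identity for `[A B]`: the part `A M₁ y` contributes only to order
    -- `0`, the part `B M₂ y` is seen by the transfer function.
    have hy : φ ϖ ^ d • ((A.map φ)⁻¹ *ᵥ (φ ∘ (B *ᵥ (M₂ *ᵥ y)))) =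
        φ ∘ (x - ϖ ^ d • (M₁ *ᵥ y)) := by
      have h1 : B *ᵥ (M₂ *ᵥ y) = y - A *ᵥ (M₁ *ᵥ y) := by
        rw [eq_sub_iff_add_eq', mulVec_mulVec, mulVec_mulVec, ← add_mulVec, hM, one_mulVec]
      rw [h1, comp_sub, comp_sub, mulVec_sub, smul_sub, ← h, comp_mulVec φ A, mulVec_mulVec,
        nonsing_inv_mul _ hu, one_mulVec, ← comp_pow_smul]
    refine ⟨residue O ∘ (C *ᵥ x + ϖ ^ d • (D *ᵥ (M₂ *ᵥ y) - C *ᵥ (M₁ *ᵥ y))),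
      ⟨_, M₂ *ᵥ y, ?_, rfl⟩, ?_⟩
    · rw [zpow_neg_smul_eq_iff hw, hT, smul_add, ← mulVec_smul, hy, ← comp_mulVec,
        ← comp_pow_smul, ← comp_add, mulVec_sub,
        mulVec_smul, smul_sub]
      congr 1
      abel
    · have h2 : N₂ *ᵥ (C *ᵥ x) = x + ϖ ^ d • (-(N₁ *ᵥ y)) := by
        have : N₁ *ᵥ (A *ᵥ x) + N₂ *ᵥ (C *ᵥ x) = x := by
          rw [mulVec_mulVec, mulVec_mulVec, ← add_mulVec, hN, one_mulVec]
        rw [hAx, mulVec_smul] at this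
        rw [smul_neg, ← sub_eq_add_neg, eq_sub_iff_add_eq', this]
      rw [comp_add, comp_pow_smul, hresd, zero_smul, add_zero, toLin'_apply, ← comp_mulVec,
        h2, comp_add, comp_pow_smul, hresd, zero_smul, add_zero]

end Rosenbrock

/-! ### Existence and uniqueness of the local Smith form -/

section Existence

theorem rank_eq_of_localEquiv {ι κ : Type*} [Fintype ι] [Fintype κ] [DecidableEq ι] [DecidableEq κ]
    {G H : Matrix ι κ K} (h : LocalEquiv O G H) : G.rank = H.rank := by
  obtain ⟨U, V, hU, hV, rfl⟩ := h
  have hU' : IsUnit (U.map (algebraMap O K)).det :=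
    (isUnit_iff_isUnit_det _).1 (hU.map (algebraMap O K).mapMatrix)
  have hV' : IsUnit (V.map (algebraMap O K)).det :=
    (isUnit_iff_isUnit_det _).1 (hV.map (algebraMap O K).mapMatrix)
  rw [rank_mul_eq_left_of_isUnit_det _ _ hV', rank_mul_eq_right_of_isUnit_det _ _ hU']

variable [IsDomain O] [IsDiscreteValuationRing O] [IsFractionRing O K]

/-- An entry of minimal order divides all entries over `O`. -/
theorem exists_pivot {ι κ : Type*} [Fintype ι] [Fintype κ] {G : Matrix ι κ K} (hG : G ≠ 0) :
    ∃ i₀ j₀, G i₀ j₀ ≠ 0 ∧ ∀ i j, ∃ c : O, G i j = algebraMap O K c * G i₀ j₀ := by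
  classical
  obtain ⟨ϖ, hϖ⟩ := IsDiscreteValuationRing.exists_irreducible O
  have hw : algebraMap O K ϖ ≠ 0 := by simpa using hϖ.ne_zero
  have hex : ∀ x : K, ∃ n : ℤ, x ≠ 0 → ∃ u : Oˣ, x = u • algebraMap O K ϖ ^ n := by
    intro x
    by_cases hx : x = 0
    · exact ⟨0, fun h => absurd hx h⟩
    · obtain ⟨n, hn⟩ := IsDiscreteValuationRing.exists_units_eq_smul_zpow_of_irreducible hϖ hx
      exact ⟨n, fun _ => hn⟩
  choose ord hord using hex
  have hne : ((Finset.univ : Finset (ι × κ)).filter fun a => G a.1 a.2 ≠ 0).Nonempty := by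
    by_contra h
    rw [Finset.not_nonempty_iff_eq_empty, Finset.filter_eq_empty_iff] at h
    exact hG (Matrix.ext fun i j => not_not.1 (h (Finset.mem_univ (i, j))))
  obtain ⟨⟨i₀, j₀⟩, h₀, hmin⟩ := Finset.exists_min_image _ (fun a => ord (G a.1 a.2)) hne
  simp only [Finset.mem_filter, Finset.mem_univ, true_and] at h₀ hmin
  refine ⟨i₀, j₀, h₀, fun i j => ?_⟩
  by_cases hij : G i j = 0
  · exact ⟨0, by simp [hij]⟩
  · have hle := hmin (i, j) hij
    obtain ⟨u, hu⟩ := hord _ h₀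
    obtain ⟨v, hv⟩ := hord _ hij
    simp only at hle
    set a := ord (G i j)
    set b := ord (G i₀ j₀)
    have hab : algebraMap O K ϖ ^ a = algebraMap O K ϖ ^ (a - b).toNat * algebraMap O K ϖ ^ b := by
      rw [← zpow_natCast, ← zpow_add₀ hw]
      congr 1
      omega
    refine ⟨v * ϖ ^ (a - b).toNat * ↑u⁻¹, ?_⟩
    have huu : algebraMap O K ↑u⁻¹ * algebraMap O K ↑u = 1 := by rw [← map_mul]; simp
    rw [hu, hv, hab]
    simp only [Units.smul_def, Algebra.smul_def, map_mul, map_pow]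
    linear_combination (-(algebraMap O K ↑v * algebraMap O K ϖ ^ (a - b).toNat *
      algebraMap O K ϖ ^ b)) * huu

/-- The bijection that lists a distinguished index `i₀` of `Fin (p + 1)` last. -/
def pivotEquiv {p : ℕ} (i₀ : Fin (p + 1)) : Fin p ⊕ Unit ≃ Fin (p + 1) :=
  ((finSuccEquiv p).trans (Equiv.optionEquivSumPUnit (Fin p))).symm.trans (Equiv.swap 0 i₀)

theorem pivotEquiv_inr {p : ℕ} (i₀ : Fin (p + 1)) (u : Unit) : pivotEquiv i₀ (Sum.inr u) = i₀ := by
  simp [pivotEquiv]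

theorem pivotEquiv_zero_inl {p : ℕ} (i : Fin p) :
    pivotEquiv (0 : Fin (p + 1)) (Sum.inl i) = i.succ := by
  simp [pivotEquiv]

theorem zpowDiag_cons_submatrix (p m : ℕ) (x : K) (a : ℤ) (ν : List ℤ) :
    (zpowDiag (p + 1) (m + 1) x (a :: ν)).submatrix (pivotEquiv 0) (pivotEquiv 0) =
      fromBlocks (zpowDiag p m x ν) 0 0 (Matrix.of fun _ _ => x ^ a) := by
  ext (i | i) (j | j) <;>
    simp [zpowDiag, pivotEquiv_inr, pivotEquiv_zero_inl]

/-- Existence of the local Smith form: every matrix over the fraction field of a discrete valuation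
ring is equivalent to a diagonal matrix of powers of the uniformizer. -/
theorem exists_localEquiv_zpowDiag {ϖ : O} (hϖ : Irreducible ϖ) :
    ∀ (p m : ℕ) (G : Matrix (Fin p) (Fin m) K), ∃ ν : List ℤ, ν.Pairwise (· ≤ ·) ∧ ν.length ≤ p ∧
      ν.length ≤ m ∧ LocalEquiv O G (zpowDiag p m (algebraMap O K ϖ) ν) := by
  have hϖm : ϖ ∈ maximalIdeal O := (mem_maximalIdeal _).2 hϖ.not_isUnit
  intro p
  induction p with
  | zero =>
    intro m G
    refine ⟨[], List.Pairwise.nil, le_rfl, Nat.zero_le _, ?_⟩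
    rw [Subsingleton.elim G (zpowDiag 0 m (algebraMap O K ϖ) [])]
    exact LocalEquiv.refl _
  | succ p ih =>
    intro m G
    by_cases hG : G = 0
    · refine ⟨[], List.Pairwise.nil, Nat.zero_le _, Nat.zero_le _, ?_⟩
      have : G = zpowDiag (p + 1) m (algebraMap O K ϖ) [] := by
        rw [hG]; ext; simp [zpowDiag]
      rw [this]
      exact LocalEquiv.refl _
    obtain ⟨i₀, j₀, h₀, hdiv⟩ := exists_pivot (O := O) hG
    choose c hc using hdiv
    obtain ⟨m, rfl⟩ : ∃ m', m = m' + 1 := ⟨m - 1, by have := j₀.pos; omega⟩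
    obtain ⟨a, u, hu⟩ := IsDiscreteValuationRing.exists_units_eq_smul_zpow_of_irreducible hϖ h₀
    let e := pivotEquiv i₀
    let f := pivotEquiv j₀
    let A : Matrix (Fin p) (Fin m) K := Matrix.of fun i j => G (e (Sum.inl i)) (f (Sum.inl j))
    let X : Matrix (Fin p) Unit O := Matrix.of fun i _ => c (e (Sum.inl i)) j₀
    let Y : Matrix Unit (Fin m) O := Matrix.of fun _ j => c i₀ (f (Sum.inl j))
    let D : Matrix Unit Unit K := Matrix.of fun _ _ => G i₀ j₀
    have hblock : G.submatrix e f =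
        fromBlocks A (X.map (algebraMap O K) * D) (D * Y.map (algebraMap O K)) D := by
      ext (i | i) (j | j)
      · rfl
      · simp [X, D, Matrix.mul_apply, e, f, pivotEquiv_inr, ← hc]
      · simp [Y, D, Matrix.mul_apply, e, f, pivotEquiv_inr]
        rw [hc i₀, mul_comm]
      · simp [D, e, f, pivotEquiv_inr]
    set S := A - X.map (algebraMap O K) * D * Y.map (algebraMap O K) with hS
    obtain ⟨ν, hν, hp, hm, hequiv⟩ := ih m S
    -- The Schur complement is still divisible by the pivot, so its orders are at least `a`.
    obtain ⟨T, hT⟩ : ∃ T : Matrix (Fin p) (Fin m) O,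
        S = (algebraMap O K ϖ) ^ a • T.map (algebraMap O K) := by
      refine ⟨Matrix.of fun i j => u * (c (e (Sum.inl i)) (f (Sum.inl j)) -
        c (e (Sum.inl i)) j₀ * c i₀ (f (Sum.inl j))), ?_⟩
      ext i j
      simp only [hS, A, X, D, Y, Matrix.sub_apply, Matrix.mul_apply, Matrix.of_apply,
        Matrix.map_apply, Finset.univ_unique, Finset.sum_singleton, Matrix.smul_apply,
        smul_eq_mul, map_mul, map_sub]
      rw [hc (e (Sum.inl i)) (f (Sum.inl j)), hu, Units.smul_def, Algebra.smul_def]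
      ring
    have hge : ∀ b ∈ ν, a ≤ b := by
      intro b hb
      by_contra hlt
      have h1 := orderCount_zpowDiag (K := K) hϖm hϖ.ne_zero b hp hm
      rw [← hequiv.orderCount_eq hϖ.ne_zero, orderCount, hT,
        leadingSpace_eq_bot hϖm hϖ.ne_zero (not_le.1 hlt), finrank_bot, eq_comm,
        List.countP_eq_zero] at h1
      exact h1 b hb (by simp)
    refine ⟨a :: ν, List.pairwise_cons.2 ⟨hge, hν⟩, by simpa using hp, by simpa using hm, ?_⟩
    refine LocalEquiv.of_submatrix e (pivotEquiv 0) f (pivotEquiv 0) ?_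
    rw [hblock, zpowDiag_cons_submatrix]
    refine (LocalEquiv.eliminate A X Y D).trans (LocalEquiv.fromBlocks_diagonal hequiv ?_)
    refine ⟨Matrix.of fun _ _ => ↑u⁻¹, 1, ?_, isUnit_one, ?_⟩
    · rw [isUnit_iff_isUnit_det, det_unique]
      exact u⁻¹.isUnit
    · have huu : algebraMap O K ↑u⁻¹ * algebraMap O K ↑u = 1 := by rw [← map_mul]; simp
      ext i j
      rw [Matrix.map_one _ (map_zero (algebraMap O K)) (map_one _), Matrix.mul_one]
      simp only [D, Matrix.mul_apply, Finset.univ_unique, Finset.sum_singleton, Matrix.map_apply,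
        Matrix.of_apply]
      rw [hu, Units.smul_def, Algebra.smul_def, ← mul_assoc, huu, one_mul]

/-- The local Smith form of `G` is determined by the dimensions of the leading spaces of `G`. -/
theorem localEquiv_zpowDiag_iff {ϖ : O} (hϖ : Irreducible ϖ) {p m : ℕ}
    (G : Matrix (Fin p) (Fin m) K) (ν : List ℤ) :
    (ν.Pairwise (· ≤ ·) ∧ ν.length = G.rank ∧
      LocalEquiv O G (zpowDiag p m (algebraMap O K ϖ) ν)) ↔
    (ν.Pairwise (· ≤ ·) ∧ ∀ k : ℤ, ν.countP (fun a => a ≤ k) = orderCount ϖ k G) := by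
  have hϖm : ϖ ∈ maximalIdeal O := (mem_maximalIdeal _).2 hϖ.not_isUnit
  constructor
  · rintro ⟨hν, hlen, hequiv⟩
    have hp : ν.length ≤ p := hlen ▸ (rank_le_height G)
    have hm : ν.length ≤ m := hlen ▸ (rank_le_width G)
    exact ⟨hν, fun k => by
      rw [hequiv.orderCount_eq hϖ.ne_zero, orderCount_zpowDiag hϖm hϖ.ne_zero k hp hm]⟩
  · rintro ⟨hν, hcount⟩
    obtain ⟨ν', hν', hp, hm, hequiv⟩ := exists_localEquiv_zpowDiag (K := K) hϖ p m G
    have : ν = ν' := eq_of_countP_le_eq hν hν' fun k => by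
      rw [hcount, hequiv.orderCount_eq hϖ.ne_zero, orderCount_zpowDiag hϖm hϖ.ne_zero k hp hm]
    subst this
    refine ⟨hν, ?_, hequiv⟩
    rw [rank_eq_of_localEquiv hequiv, rank_zpowDiag (by simpa using hϖ.ne_zero) hp hm]

end Existence

end LocalSmith

namespace RationalMatrix

open Matrix IsLocalRing LocalSmith

variable {F : Type*} [Field F]

/-! ### The local ring of rational functions at a point -/

section LocalRing

theorem eval_ne_zero_of_dvd {p q : F[X]} {a : F} (h : p ∣ q) (hq : q.eval a ≠ 0) :
    p.eval a ≠ 0 := by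
  obtain ⟨r, rfl⟩ := h
  rw [eval_mul] at hq
  exact left_ne_zero_of_mul hq

/-- The local ring at `a`: the rational functions defined at `a`. -/
def localSubring (a : F) : Subring (RatFunc F) where
  carrier := {f | f.denom.eval a ≠ 0}
  mul_mem' {f g} hf hg := eval_ne_zero_of_dvd (RatFunc.denom_mul_dvd f g) (by
    rw [eval_mul]; exact mul_ne_zero hf hg)
  one_mem' := by simp
  add_mem' {f g} hf hg := eval_ne_zero_of_dvd (RatFunc.denom_add_dvd f g) (by
    rw [eval_mul]; exact mul_ne_zero hf hg)
  zero_mem' := by simp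
  neg_mem' {f} hf := by
    have : -f = algebraMap F[X] (RatFunc F) (-f.num) / algebraMap F[X] (RatFunc F) f.denom := by
      rw [map_neg, neg_div, RatFunc.num_div_denom]
    change (-f).denom.eval a ≠ 0
    rw [this]
    exact eval_ne_zero_of_dvd (RatFunc.denom_div_dvd _ _) hf

theorem mem_localSubring {a : F} {f : RatFunc F} : f ∈ localSubring a ↔ f.denom.eval a ≠ 0 :=
  Iff.rfl

theorem div_mem_localSubring {a : F} (p : F[X]) {q : F[X]} (hq : q.eval a ≠ 0) :
    algebraMap F[X] (RatFunc F) p / algebraMap F[X] (RatFunc F) q ∈ localSubring a :=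
  eval_ne_zero_of_dvd (RatFunc.denom_div_dvd _ _) hq

theorem algebraMap_mem_localSubring (a : F) (p : F[X]) :
    algebraMap F[X] (RatFunc F) p ∈ localSubring a := by
  simp [mem_localSubring]

noncomputable instance (a : F) : Algebra F[X] (localSubring a) :=
  ((algebraMap F[X] (RatFunc F)).codRestrict (localSubring a)
    (algebraMap_mem_localSubring a)).toAlgebra

instance (a : F) : IsScalarTower F[X] (localSubring a) (RatFunc F) :=
  IsScalarTower.of_algebraMap_eq fun _ => rfl

instance (a : F) : FaithfulSMul (localSubring a) (RatFunc F) :=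
  (faithfulSMul_iff_algebraMap_injective _ _).2 Subtype.val_injective

theorem coe_algebraMap_localSubring (a : F) (p : F[X]) :
    (algebraMap F[X] (localSubring a) p : RatFunc F) = algebraMap F[X] (RatFunc F) p := rfl

instance (a : F) : (Ideal.span {X - C a} : Ideal F[X]).IsPrime :=
  (Ideal.span_singleton_prime (X_sub_C_ne_zero a)).2 (prime_X_sub_C a)

theorem mem_primeCompl_span {a : F} {p : F[X]} :
    p ∈ (Ideal.span {X - C a} : Ideal F[X]).primeCompl ↔ p.eval a ≠ 0 := by
  rw [Ideal.mem_primeCompl_iff, Ideal.mem_span_singleton, dvd_iff_isRoot, IsRoot.def]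

instance (a : F) : IsLocalization.AtPrime (localSubring a) (Ideal.span {X - C a} : Ideal F[X]) where
  map_units := by
    rintro ⟨q, hq⟩
    rw [mem_primeCompl_span] at hq
    have hq0 : algebraMap F[X] (RatFunc F) q ≠ 0 := by
      rw [ne_eq, map_eq_zero_iff _ (RatFunc.algebraMap_injective F)]
      rintro rfl
      simp at hq
    refine IsUnit.of_mul_eq_one ⟨_, div_mem_localSubring 1 hq⟩ (Subtype.ext ?_)
    simp [coe_algebraMap_localSubring, hq0]
  surj := by
    rintro ⟨f, hf⟩
    refine ⟨(f.num, ⟨f.denom, mem_primeCompl_span.2 hf⟩), Subtype.ext ?_⟩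
    have := RatFunc.num_div_denom f
    rw [div_eq_iff (by simp [RatFunc.denom_ne_zero])] at this
    simpa [coe_algebraMap_localSubring] using this.symm
  exists_of_eq := by
    intro p q h
    refine ⟨1, ?_⟩
    rw [RatFunc.algebraMap_injective F (congrArg Subtype.val h)]

instance (a : F) : IsFractionRing (localSubring a) (RatFunc F) :=
  IsFractionRing.isFractionRing_of_isDomain_of_isLocalization
    (Ideal.span {X - C a} : Ideal F[X]).primeCompl _ _

instance (a : F) : IsDiscreteValuationRing (localSubring a) :=
  IsLocalization.AtPrime.isDiscreteValuationRing_of_dedekind_domain F[X]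
    (by rw [ne_eq, Ideal.span_singleton_eq_bot]; exact X_sub_C_ne_zero a)
    (localSubring a) (P := Ideal.span {X - C a})

theorem irreducible_X_sub_C_localSubring (a : F) :
    Irreducible (algebraMap F[X] (localSubring a) (X - C a)) := by
  rw [IsDiscreteValuationRing.irreducible_iff_uniformizer,
    ← IsLocalization.AtPrime.map_eq_maximalIdeal (Ideal.span {X - C a} : Ideal F[X])
      (localSubring a), Ideal.map_span, Set.image_singleton]

/-- Evaluation at `a` of the rational functions defined at `a`. -/
noncomputable def evalHom (a : F) : localSubring a →+* F where
  toFun f := RatFunc.eval (RingHom.id F) a f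
  map_one' := RatFunc.eval_one _ _
  map_zero' := RatFunc.eval_zero _ _
  map_mul' f g := RatFunc.eval_mul _ _ f.2 g.2
  map_add' f g := RatFunc.eval_add _ _ f.2 g.2

theorem evalHom_algebraMap (a : F) (p : F[X]) :
    evalHom a (algebraMap F[X] (localSubring a) p) = p.eval a := by
  simp [evalHom, coe_algebraMap_localSubring, Polynomial.eval₂_id]

theorem isUnit_iff_evalHom_ne_zero {a : F} (f : localSubring a) : IsUnit f ↔ evalHom a f ≠ 0 := by
  constructor
  · intro h
    exact (h.map (evalHom a)).ne_zero
  · intro h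
    obtain ⟨p, q, rfl⟩ := IsLocalization.exists_mk'_eq
      (Ideal.span {X - C a} : Ideal F[X]).primeCompl f
    have h1 := congrArg (evalHom a)
      (IsLocalization.mk'_spec (localSubring a) p q)
    rw [map_mul, evalHom_algebraMap, evalHom_algebraMap] at h1
    have hp : p.eval a ≠ 0 := by
      rw [← h1]
      exact mul_ne_zero h (mem_primeCompl_span.1 q.2)
    have hu := IsLocalization.map_units (localSubring a)
      (⟨p, mem_primeCompl_span.2 hp⟩ : (Ideal.span {X - C a} : Ideal F[X]).primeCompl)
    rw [← IsLocalization.mk'_spec (localSubring a) p q] at hu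
    exact isUnit_of_mul_isUnit_left hu

theorem regularAt_iff {p : ℕ} {R : Matrix (Fin p) (Fin p) (RatFunc F)} {a : F} :
    RegularAt R a ↔ ∃ U : Matrix (Fin p) (Fin p) (localSubring a), IsUnit U ∧
      U.map (algebraMap (localSubring a) (RatFunc F)) = R := by
  have key : ∀ U : Matrix (Fin p) (Fin p) (localSubring a),
      (evalAt (U.map (algebraMap (localSubring a) (RatFunc F))) a).det ≠ 0 ↔ IsUnit U := by
    intro U
    rw [isUnit_iff_isUnit_det, isUnit_iff_evalHom_ne_zero, RingHom.map_det]
    rfl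
  constructor
  · rintro ⟨h1, h2⟩
    exact ⟨Matrix.of fun i j => ⟨R i j, h1 i j⟩, (key _).1 h2, rfl⟩
  · rintro ⟨U, hU, rfl⟩
    exact ⟨fun i j => (U i j).2, (key U).2 hU⟩

theorem equivalentAt_iff_localEquiv {p m : ℕ} {a : F} {G H : Matrix (Fin p) (Fin m) (RatFunc F)} :
    EquivalentAt a G H ↔ LocalEquiv (localSubring a) G H := by
  constructor
  · rintro ⟨R₁, R₂, h₁, h₂, h⟩
    obtain ⟨U, hU, rfl⟩ := regularAt_iff.1 h₁
    obtain ⟨V, hV, rfl⟩ := regularAt_iff.1 h₂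
    exact ⟨U, V, hU, hV, h⟩
  · rintro ⟨U, V, hU, hV, h⟩
    exact ⟨_, _, regularAt_iff.2 ⟨U, hU, rfl⟩, regularAt_iff.2 ⟨V, hV, rfl⟩, h⟩

/-- The number of invariant orders `≤ k` of `G` at `a`. -/
noncomputable def orderCountAt {ι κ : Type*} [Fintype ι] [Fintype κ] (a : F) (k : ℤ)
    (G : Matrix ι κ (RatFunc F)) : ℕ :=
  orderCount (algebraMap F[X] (localSubring a) (X - C a)) k G

/-- The invariant orders at `a` are the nondecreasing list with the counts given by the leading
spaces at `a`. -/
theorem isInvariantOrdersAt_iff {p m : ℕ} {a : F} {G : Matrix (Fin p) (Fin m) (RatFunc F)}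
    {ν : List ℤ} : IsInvariantOrdersAt G a ν ↔
      ν.Pairwise (· ≤ ·) ∧ ∀ k : ℤ, ν.countP (fun b => b ≤ k) = orderCountAt a k G := by
  have h := localEquiv_zpowDiag_iff (irreducible_X_sub_C_localSubring a) G ν
  have hX : algebraMap (localSubring a) (RatFunc F) (algebraMap F[X] (localSubring a) (X - C a)) =
      RatFunc.X - RatFunc.C a := by
    rw [← IsScalarTower.algebraMap_apply, map_sub, RatFunc.algebraMap_X, RatFunc.algebraMap_C]
  rw [hX, ← equivalentAt_iff_localEquiv] at h
  exact h

end LocalRing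

/-! ### Invariant orders at infinity -/

section Infinity

theorem eval₂_C_X_inv_ne_zero {q : F[X]} (hq : q ≠ 0) :
    q.eval₂ (RatFunc.C : F →+* RatFunc F) (RatFunc.X)⁻¹ ≠ 0 := by
  intro h
  have h1 := reflect_subst q.natDegree (reflect q.natDegree q)
    (by simpa using natDegree_reflect_le (N := q.natDegree) (p := q))
  rw [reflect_reflect, h, mul_zero, map_eq_zero_iff _ (RatFunc.algebraMap_injective F)] at h1
  exact hq (by simpa using h1)

/-- The automorphism `f(λ) ↦ f(1/λ)` of the field of rational functions. -/
noncomputable def invSubst : RatFunc F →+* RatFunc F where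
  toFun := RatFunc.eval (RatFunc.C : F →+* RatFunc F) (RatFunc.X)⁻¹
  map_one' := RatFunc.eval_one _ _
  map_zero' := RatFunc.eval_zero _ _
  map_mul' f g := RatFunc.eval_mul _ _ (eval₂_C_X_inv_ne_zero f.denom_ne_zero)
    (eval₂_C_X_inv_ne_zero g.denom_ne_zero)
  map_add' f g := RatFunc.eval_add _ _ (eval₂_C_X_inv_ne_zero f.denom_ne_zero)
    (eval₂_C_X_inv_ne_zero g.denom_ne_zero)

theorem invSubst_C (c : F) : invSubst (RatFunc.C c) = RatFunc.C c := RatFunc.eval_C _ _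

theorem invSubst_X : invSubst (RatFunc.X : RatFunc F) = (RatFunc.X)⁻¹ := RatFunc.eval_X _ _

theorem invSubst_invSubst (f : RatFunc F) : invSubst (invSubst f) = f := by
  have : (invSubst.comp invSubst : RatFunc F →+* RatFunc F) = RingHom.id _ := by
    refine IsLocalization.ringHom_ext (nonZeroDivisors F[X]) (Polynomial.ringHom_ext ?_ ?_)
    · intro c
      simp [RatFunc.algebraMap_C, invSubst_C]
    · simp [RatFunc.algebraMap_X, invSubst_X]
  exact RingHom.congr_fun this f

theorem substInv_eq_map {p m : ℕ} (G : Matrix (Fin p) (Fin m) (RatFunc F)) :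
    substInv G = G.map invSubst := rfl

theorem substInv_substInv {p m : ℕ} (G : Matrix (Fin p) (Fin m) (RatFunc F)) :
    substInv (substInv G) = G := by
  ext i j : 2
  exact invSubst_invSubst _

theorem substInv_mul {p m l : ℕ} (G : Matrix (Fin p) (Fin m) (RatFunc F))
    (H : Matrix (Fin m) (Fin l) (RatFunc F)) : substInv (G * H) = substInv G * substInv H :=
  Matrix.map_mul (f := invSubst)

theorem equivalentAtInfty_iff {p m : ℕ} {G H : Matrix (Fin p) (Fin m) (RatFunc F)} :
    EquivalentAtInfty G H ↔ EquivalentAt 0 (substInv G) (substInv H) := by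
  constructor
  · rintro ⟨R₁, R₂, h₁, h₂, rfl⟩
    exact ⟨_, _, h₁, h₂, by rw [substInv_mul, substInv_mul]⟩
  · rintro ⟨R₁, R₂, h₁, h₂, h⟩
    refine ⟨substInv R₁, substInv R₂, ?_, ?_, ?_⟩
    · rwa [RegularAtInfty, substInv_substInv]
    · rwa [RegularAtInfty, substInv_substInv]
    · rw [← substInv_substInv H, ← h, substInv_mul, substInv_mul, substInv_substInv]

theorem rank_eq_of_equivalentAt {p m : ℕ} {a : F} {G H : Matrix (Fin p) (Fin m) (RatFunc F)}
    (h : EquivalentAt a G H) : G.rank = H.rank :=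
  rank_eq_of_localEquiv (equivalentAt_iff_localEquiv.1 h)

theorem rank_eq_of_equivalentAtInfty {p m : ℕ} {G H : Matrix (Fin p) (Fin m) (RatFunc F)}
    (h : EquivalentAtInfty G H) : G.rank = H.rank := by
  have key : ∀ {n : ℕ} {R : Matrix (Fin n) (Fin n) (RatFunc F)}, RegularAtInfty R →
      IsUnit R.det := by
    intro n R hR
    obtain ⟨U, hU, hUR⟩ := regularAt_iff.1 hR
    have h1 : IsUnit (substInv R).det := by
      rw [← hUR]
      exact (isUnit_iff_isUnit_det _).1
        (hU.map (algebraMap (localSubring (0 : F)) (RatFunc F)).mapMatrix)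
    rw [substInv_eq_map, ← RingHom.mapMatrix_apply, ← RingHom.map_det] at h1
    rw [isUnit_iff_ne_zero] at h1 ⊢
    exact fun h0 => h1 (by rw [h0, map_zero])
  obtain ⟨R₁, R₂, h₁, h₂, rfl⟩ := h
  rw [rank_mul_eq_left_of_isUnit_det _ _ (key h₂), rank_mul_eq_right_of_isUnit_det _ _ (key h₁)]

theorem rank_diagPow {p m : ℕ} {x : RatFunc F} (hx : x ≠ 0) {ν : List ℤ} (hp : ν.length ≤ p)
    (hm : ν.length ≤ m) : (diagPow p m x ν).rank = ν.length :=
  rank_zpowDiag hx hp hm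

/-- Passing to the `g`-reversal moves the invariant orders from infinity to `0` and shifts them
by `g`. -/
theorem isInvariantOrdersAtInfty_iff_revRat {p m : ℕ} (g : ℤ)
    (G : Matrix (Fin p) (Fin m) (RatFunc F)) (q : List ℤ) :
    IsInvariantOrdersAtInfty G q ↔
      IsInvariantOrdersAt (revRat g G) 0 (q.map fun x => x + g) := by
  have hX : (RatFunc.X : RatFunc F) ≠ 0 := RatFunc.X_ne_zero
  have hdiag : diagPow p m (RatFunc.X - RatFunc.C (0 : F)) (q.map fun x => x + g) =
      (RatFunc.X : RatFunc F) ^ g • substInv (diagPow p m (RatFunc.X)⁻¹ q) := by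
    rw [substInv_eq_map, map_zero, sub_zero]
    ext i j : 2
    simp only [diagPow, Matrix.of_apply, Matrix.smul_apply, Matrix.map_apply, smul_eq_mul,
      List.length_map, List.getElem_map]
    split_ifs with h1 h2
    · rw [map_zpow₀, map_inv₀, invSubst_X, inv_inv, ← zpow_add₀ hX, add_comm]
    · simp
    · simp
  have hequiv : EquivalentAtInfty G (diagPow p m (RatFunc.X)⁻¹ q) ↔
      EquivalentAt 0 (revRat g G)
        (diagPow p m (RatFunc.X - RatFunc.C (0 : F)) (q.map fun x => x + g)) := by
    rw [equivalentAtInfty_iff, hdiag, revRat]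
    constructor
    · rintro ⟨R₁, R₂, h₁, h₂, h⟩
      exact ⟨R₁, R₂, h₁, h₂, by rw [Matrix.mul_smul, Matrix.smul_mul, h]⟩
    · rintro ⟨R₁, R₂, h₁, h₂, h⟩
      refine ⟨R₁, R₂, h₁, h₂, smul_right_injective _ (zpow_ne_zero g hX) ?_⟩
      simpa only [Matrix.mul_smul, Matrix.smul_mul] using h
  have hsorted : (q.map fun x => x + g).Pairwise (· ≤ ·) ↔ q.Pairwise (· ≤ ·) := by
    simp [List.pairwise_map]
  have hX' : RatFunc.X - RatFunc.C (0 : F) ≠ 0 := by simpa using hX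
  -- The two rank conditions agree, since both ranks are read off from the diagonal form.
  constructor
  · rintro ⟨h1, h2, h3⟩
    have hp : q.length ≤ p := h2 ▸ rank_le_height G
    have hm : q.length ≤ m := h2 ▸ rank_le_width G
    refine ⟨hsorted.2 h1, ?_, hequiv.1 h3⟩
    rw [rank_eq_of_equivalentAt (hequiv.1 h3), rank_diagPow hX' (by simpa) (by simpa)]
  · rintro ⟨h1, h2, h3⟩
    have hp : (q.map fun x => x + g).length ≤ p := h2 ▸ rank_le_height _
    have hm : (q.map fun x => x + g).length ≤ m := h2 ▸ rank_le_width _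
    refine ⟨hsorted.1 h1, ?_, hequiv.2 h3⟩
    rw [List.length_map] at hp hm
    rw [rank_eq_of_equivalentAtInfty (hequiv.2 h3), rank_diagPow (inv_ne_zero hX) hp hm]

end Infinity

/-! ### Reversal and minimality of system matrices -/

section SystemMatrices

theorem PolynomialSystemMatrix.natDegree_le_degree {n q r : ℕ}
    (P : PolynomialSystemMatrix F n q r) :
    (∀ i j, (P.B i j).natDegree ≤ P.degree) ∧ (∀ i j, (P.C i j).natDegree ≤ P.degree) ∧
      ∀ i j, (P.D i j).natDegree ≤ P.degree := by
  refine ⟨fun i j => ?_, fun i j => ?_, fun i j => ?_⟩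
  · simpa [toMatrix, degree] using
      natDegree_le_matDegree P.toMatrix (Fin.castAdd q i) (Fin.natAdd n j)
  · simpa [toMatrix, degree] using
      natDegree_le_matDegree P.toMatrix (Fin.natAdd n i) (Fin.castAdd r j)
  · simpa [toMatrix, degree] using
      natDegree_le_matDegree P.toMatrix (Fin.natAdd n i) (Fin.natAdd n j)

theorem isUnit_det_toRat {n : ℕ} {A : Matrix (Fin n) (Fin n) F[X]} (hA : A.det ≠ 0) :
    IsUnit (toRat A).det := by
  rw [toRat, ← RingHom.mapMatrix_apply, ← RingHom.map_det, isUnit_iff_ne_zero]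
  exact (map_ne_zero_iff _ (RatFunc.algebraMap_injective F)).2 hA

theorem PolynomialSystemMatrix.rev_transfer {n q r : ℕ} (P : PolynomialSystemMatrix F n q r) :
    P.rev.transfer = revRat (P.degree : ℤ) P.transfer := by
  obtain ⟨hB, hC, hD⟩ := P.natDegree_le_degree
  have hx : (RatFunc.X : RatFunc F) ^ (P.degree : ℤ) ≠ 0 := zpow_ne_zero _ RatFunc.X_ne_zero
  have hu := isUnit_det_toRat P.nonsing
  have hinv : (revRat (P.degree : ℤ) (toRat P.A))⁻¹ =
      ((RatFunc.X : RatFunc F) ^ (P.degree : ℤ))⁻¹ • substInv (toRat P.A)⁻¹ := by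
    refine inv_eq_right_inv ?_
    rw [revRat, Matrix.smul_mul, Matrix.mul_smul, smul_smul, mul_inv_cancel₀ hx, one_smul,
      ← substInv_mul, mul_nonsing_inv _ hu, substInv_eq_map,
      Matrix.map_one _ (map_zero invSubst) (map_one _)]
  have hadd : substInv P.transfer = substInv (toRat P.D) +
      substInv (toRat P.C) * substInv (toRat P.A)⁻¹ * substInv (toRat P.B) := by
    rw [← substInv_mul, ← substInv_mul]
    exact Matrix.map_add _ (map_add invSubst) _ _
  simp only [transfer, rev, toRat_revPoly _ _ hB, toRat_revPoly _ _ hC, toRat_revPoly _ _ hD,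
    toRat_revPoly _ _ P.natDegree_A_le]
  rw [hinv, revRat, revRat, revRat, revRat]
  change _ = _ • substInv P.transfer
  rw [hadd, smul_add, Matrix.mul_smul, Matrix.smul_mul, Matrix.mul_smul, Matrix.smul_mul,
    Matrix.smul_mul, smul_smul, smul_smul, mul_inv_cancel_right₀ hx]

theorem exists_left_inverse_of_rank {K ι κ : Type*} [Field K] [Fintype ι] [Fintype κ]
    [DecidableEq κ] {M : Matrix ι κ K} (h : M.rank = Fintype.card κ) :
    ∃ N : Matrix κ ι K, N * M = 1 := by
  rw [← vecMul_surjective_iff_exists_left_inverse]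
  have h1 : LinearMap.range (Mᵀ).mulVecLin = ⊤ := by
    refine Submodule.eq_top_of_finrank_eq ?_
    rw [Module.finrank_fintype_fun_eq_card, ← h, ← rank_transpose M, rank]
  intro v
  obtain ⟨w, hw⟩ := LinearMap.range_eq_top.1 h1 v
  exact ⟨w, by rw [← hw, mulVecLin_apply, mulVec_transpose]⟩

/-- A polynomial matrix regarded as a matrix over the local ring at `a`. -/
noncomputable def toLocal (a : F) {ι κ : Type*} (P : Matrix ι κ F[X]) :
    Matrix ι κ (localSubring a) :=
  P.map (algebraMap F[X] (localSubring a))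

theorem map_toLocal (a : F) {p m : ℕ} (P : Matrix (Fin p) (Fin m) F[X]) :
    (toLocal a P).map (algebraMap (localSubring a) (RatFunc F)) = toRat P := rfl

/-- Full column rank at `a` of a block column gives a Bézout identity over the local ring: a left
inverse of the values, lifted to constants, is a left inverse up to a local unit. -/
theorem exists_bezout_of_rank_fromRows {n q : ℕ} {a : F} {A : Matrix (Fin n) (Fin n) F[X]}
    {C : Matrix (Fin q) (Fin n) F[X]}
    (h : (fromRows (A.map (Polynomial.eval a)) (C.map (Polynomial.eval a))).rank = n) :
    ∃ (N₁ : Matrix (Fin n) (Fin n) (localSubring a)) (N₂ : Matrix (Fin n) (Fin q) (localSubring a)),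
      N₁ * toLocal a A + N₂ * toLocal a C = 1 := by
  obtain ⟨N, hN⟩ := exists_left_inverse_of_rank (h.trans (Fintype.card_fin n).symm)
  rw [← fromCols_toCols N, fromCols_mul_fromRows] at hN
  let c : F →+* localSubring a := (algebraMap F[X] (localSubring a)).comp Polynomial.C
  have hc : ∀ {l : ℕ} (M : Matrix (Fin n) (Fin l) F), (M.map c).map (evalHom a) = M := by
    intro l M
    ext i j
    simp [c, evalHom_algebraMap]
  have hloc : ∀ {k l : ℕ} (M : Matrix (Fin k) (Fin l) F[X]),
      (toLocal a M).map (evalHom a) = M.map (Polynomial.eval a) := by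
    intro k l M
    ext i j
    simp [toLocal, evalHom_algebraMap]
  set E := N.toCols₁.map c * toLocal a A + N.toCols₂.map c * toLocal a C with hE
  have hE1 : E.map (evalHom a) = 1 := by
    rw [hE, Matrix.map_add _ (map_add (evalHom a)), Matrix.map_mul, Matrix.map_mul, hc, hc, hloc,
      hloc, hN]
  have hEu : IsUnit E.det := by
    rw [isUnit_iff_evalHom_ne_zero, RingHom.map_det, RingHom.mapMatrix_apply, hE1, det_one]
    exact one_ne_zero
  refine ⟨E⁻¹ * N.toCols₁.map c, E⁻¹ * N.toCols₂.map c, ?_⟩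
  rw [Matrix.mul_assoc, Matrix.mul_assoc, ← Matrix.mul_add, ← hE, nonsing_inv_mul _ hEu]

theorem exists_bezout_of_rank_fromCols {n r : ℕ} {a : F} {A : Matrix (Fin n) (Fin n) F[X]}
    {B : Matrix (Fin n) (Fin r) F[X]}
    (h : (fromCols (A.map (Polynomial.eval a)) (B.map (Polynomial.eval a))).rank = n) :
    ∃ (M₁ : Matrix (Fin n) (Fin n) (localSubring a)) (M₂ : Matrix (Fin r) (Fin n) (localSubring a)),
      toLocal a A * M₁ + toLocal a B * M₂ = 1 := by
  rw [← rank_transpose, transpose_fromCols, ← transpose_map, ← transpose_map] at h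
  obtain ⟨N₁, N₂, hN⟩ := exists_bezout_of_rank_fromRows h
  refine ⟨N₁ᵀ, N₂ᵀ, ?_⟩
  have := congrArg Matrix.transpose hN
  rwa [transpose_add, transpose_mul, transpose_mul, transpose_one] at this

end SystemMatrices

/-! ### Counts of invariant orders at a point -/

section Counting

theorem X_sub_C_mem_maximalIdeal (a : F) :
    algebraMap F[X] (localSubring a) (X - C a) ∈ maximalIdeal (localSubring a) :=
  (mem_maximalIdeal _).2 (irreducible_X_sub_C_localSubring a).not_isUnit

theorem orderCountAt_diagOne {p m : ℕ} (a : F) (k : ℤ) (G : Matrix (Fin p) (Fin m) (RatFunc F))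
    (s : ℕ) : orderCountAt a k (diagOne G s) = orderCountAt a k G + if 0 ≤ k then s else 0 := by
  rw [orderCountAt, diagOne, reindex_apply,
    orderCount_submatrix (irreducible_X_sub_C_localSubring a).ne_zero,
    orderCount_fromBlocks_diagonal, orderCount_one (X_sub_C_mem_maximalIdeal a)
      (irreducible_X_sub_C_localSubring a).ne_zero, Fintype.card_fin, orderCountAt]

/-- A polynomial matrix has no negative invariant orders at a finite point. -/
theorem orderCountAt_toRat_of_neg {p m : ℕ} (a : F) {k : ℤ} (hk : k < 0)
    (P : Matrix (Fin p) (Fin m) F[X]) : orderCountAt a k (toRat P) = 0 := by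
  have := leadingSpace_eq_bot (K := RatFunc F) (X_sub_C_mem_maximalIdeal a)
    (irreducible_X_sub_C_localSubring a).ne_zero hk (toLocal a P)
  rw [zpow_zero, one_smul, map_toLocal] at this
  rw [orderCountAt, orderCount, this, finrank_bot]

theorem diagPow_inv {n : ℕ} {x : RatFunc F} (hx : x ≠ 0) {ν : List ℤ} (hν : ν.length = n) :
    (diagPow n n x ν)⁻¹ = diagPow n n x (ν.map fun b => -b) := by
  have hdiag : ∀ {ν : List ℤ} (hν : ν.length = n), diagPow n n x ν =
      Matrix.diagonal fun i : Fin n => x ^ ν[(i : ℕ)]'(hν ▸ i.2) := by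
    intro ν hν
    ext i j : 2
    simp [diagPow, Matrix.diagonal_apply, hν, Fin.ext_iff]
  rw [hdiag hν, hdiag (by simpa using hν)]
  refine inv_eq_right_inv ?_
  rw [diagonal_mul_diagonal, ← diagonal_one]
  congr 1
  ext i : 1
  rw [List.getElem_map, ← zpow_add₀ hx, add_neg_cancel, zpow_zero]

theorem EquivalentAt.inv {n : ℕ} {a : F} {G H : Matrix (Fin n) (Fin n) (RatFunc F)}
    (h : EquivalentAt a G H) : EquivalentAt a G⁻¹ H⁻¹ := by
  have key : ∀ {R : Matrix (Fin n) (Fin n) (RatFunc F)}, RegularAt R a → RegularAt R⁻¹ a := by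
    intro R hR
    obtain ⟨_, ⟨U, rfl⟩, rfl⟩ := regularAt_iff.1 hR
    refine regularAt_iff.2 ⟨_, U⁻¹.isUnit, (inv_eq_right_inv ?_).symm⟩
    rw [← Matrix.map_mul, Units.mul_inv, Matrix.map_one _ (map_zero _) (map_one _)]
  obtain ⟨R₁, R₂, h₁, h₂, rfl⟩ := h
  exact ⟨R₂⁻¹, R₁⁻¹, key h₂, key h₁, by
    rw [Matrix.mul_inv_rev, Matrix.mul_inv_rev, Matrix.mul_assoc]⟩

end Counting

/-! ### Invariant orders of minimal system matrices -/

section Main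

/-- Local form of Rosenbrock's theorem, for the counts of invariant orders of a minimal polynomial
system matrix. -/
theorem PolynomialSystemMatrix.orderCountAt_transfer {n q r : ℕ}
    (P : PolynomialSystemMatrix F n q r) {a : F} (hP : P.MinimalAt a) (k : ℤ) :
    (0 ≤ k → orderCountAt a k (toRat P.toMatrix) = n + orderCountAt a k P.transfer) ∧
    (k < 0 → orderCountAt a k P.transfer = orderCountAt a k (toRat P.A)⁻¹) := by
  obtain ⟨N₁, N₂, hN⟩ := exists_bezout_of_rank_fromRows hP.1
  obtain ⟨M₁, M₂, hM⟩ := exists_bezout_of_rank_fromCols hP.2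
  have hϖ0 := (irreducible_X_sub_C_localSubring a).ne_zero
  have hinj : Function.Injective (algebraMap F[X] (localSubring a)) := fun p q h =>
    RatFunc.algebraMap_injective F (congrArg Subtype.val h)
  have hA : (toLocal a P.A).det ≠ 0 := by
    rw [toLocal, ← RingHom.mapMatrix_apply, ← RingHom.map_det]
    exact (map_ne_zero_iff _ hinj).2 P.nonsing
  constructor
  · intro hk
    have h := orderCount_system (K := RatFunc F) hϖ0 hk (D := toLocal a P.D) hN hM hA
    rw [Fintype.card_fin] at h
    simp only [map_toLocal] at h
    rw [orderCountAt, orderCountAt, transfer, ← h, toMatrix, toRat, reindex_apply, ← submatrix_map,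
      orderCount_submatrix hϖ0]
    congr 1
    rw [fromBlocks_map, fromBlocks_map]
    congr 1
    ext i j
    simp only [toLocal, Matrix.map_apply, Matrix.neg_apply, map_neg]
    rfl
  · intro hk
    have h := orderCount_transfer (K := RatFunc F) (X_sub_C_mem_maximalIdeal a) hϖ0 hk
      (D := toLocal a P.D) hN hM hA
    simp only [map_toLocal] at h
    rw [orderCountAt, orderCountAt, transfer, h]

theorem exists_isInvariantOrdersAt {p m : ℕ} (a : F) (G : Matrix (Fin p) (Fin m) (RatFunc F)) :
    ∃ ν, IsInvariantOrdersAt G a ν := by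
  have hϖ := irreducible_X_sub_C_localSubring a
  obtain ⟨ν, hν, hp, hm, h⟩ := exists_localEquiv_zpowDiag (K := RatFunc F) hϖ p m G
  exact ⟨ν, isInvariantOrdersAt_iff.2 ⟨hν, fun k => by
    rw [orderCountAt, h.orderCount_eq hϖ.ne_zero,
      orderCount_zpowDiag (X_sub_C_mem_maximalIdeal a) hϖ.ne_zero k hp hm]⟩⟩

theorem IsInvariantOrdersAt.unique {p m : ℕ} {a : F} {G : Matrix (Fin p) (Fin m) (RatFunc F)}
    {ν ν' : List ℤ} (h : IsInvariantOrdersAt G a ν) (h' : IsInvariantOrdersAt G a ν') : ν = ν' := by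
  rw [isInvariantOrdersAt_iff] at h h'
  exact eq_of_countP_le_eq h.1 h'.1 fun k => (h.2 k).trans (h'.2 k).symm

theorem IsInvariantOrdersAt.nonneg {p m : ℕ} {a : F} {P : Matrix (Fin p) (Fin m) F[X]}
    {ν : List ℤ} (h : IsInvariantOrdersAt (toRat P) a ν) : ∀ b ∈ ν, 0 ≤ b := by
  intro b hb
  by_contra hlt
  have h1 := (isInvariantOrdersAt_iff.1 h).2 b
  rw [orderCountAt_toRat_of_neg a (not_le.1 hlt), List.countP_eq_zero] at h1
  exact h1 b hb (by simp)

/-- The invariant orders of the inverse are the negatives of the invariant orders. -/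
theorem IsInvariantOrdersAt.orderCountAt_inv {n : ℕ} {a : F}
    {A : Matrix (Fin n) (Fin n) (RatFunc F)} (hA : IsUnit A.det) {ν : List ℤ}
    (h : IsInvariantOrdersAt A a ν) (k : ℤ) :
    orderCountAt a k A⁻¹ = ν.countP (fun b => -b ≤ k) := by
  have hϖ := irreducible_X_sub_C_localSubring a
  obtain ⟨-, hlen, hequiv⟩ := h
  rw [rank_of_isUnit _ ((isUnit_iff_isUnit_det _).2 hA), Fintype.card_fin] at hlen
  have hX : RatFunc.X - RatFunc.C a =
      algebraMap (localSubring a) (RatFunc F) (algebraMap F[X] (localSubring a) (X - C a)) := by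
    rw [← IsScalarTower.algebraMap_apply, map_sub, RatFunc.algebraMap_X, RatFunc.algebraMap_C]
  have hX0 : RatFunc.X - RatFunc.C a ≠ 0 := by
    rw [hX, ne_eq, map_eq_zero_iff _ (FaithfulSMul.algebraMap_injective _ _)]
    exact hϖ.ne_zero
  have h1 := equivalentAt_iff_localEquiv.1 hequiv.inv
  rw [diagPow_inv hX0 hlen, hX] at h1
  have h2 := orderCount_zpowDiag (K := RatFunc F) (X_sub_C_mem_maximalIdeal a) hϖ.ne_zero k
    (ν := ν.map fun b => -b) (p := n) (m := n) (by simp [hlen]) (by simp [hlen])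
  rw [orderCountAt, h1.orderCount_eq hϖ.ne_zero]
  refine h2.trans ?_
  rw [List.countP_map]
  rfl

theorem exists_nonneg_upper_bound (l : List ℤ) : ∃ k : ℤ, 0 ≤ k ∧ ∀ b ∈ l, b ≤ k := by
  induction l with
  | nil => exact ⟨0, le_rfl, by simp⟩
  | cons b l ih =>
    obtain ⟨k, hk, h⟩ := ih
    refine ⟨max b k, le_max_of_le_right hk, ?_⟩
    intro c hc
    rcases List.mem_cons.1 hc with rfl | hc
    · exact le_max_left _ _
    · exact (h c hc).trans (le_max_right _ _)

/-- The arithmetic of the counts: a nondecreasing list `h` whose negative terms are the negatives of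
the positive terms of `α`, and whose terms `≥ 0` are those of `π` up to the number of zeros, is the
concatenation of the negated positive terms of `α`, zeros, and the positive terms of `π`. -/
theorem eq_append_of_countP {α π h : List ℤ} (hα : ∀ b ∈ α, 0 ≤ b) (hαs : α.Pairwise (· ≤ ·))
    (hπ : ∀ b ∈ π, 0 ≤ b) (hπs : π.Pairwise (· ≤ ·)) (hs : h.Pairwise (· ≤ ·)) {c d : ℕ}
    (hneg : ∀ k : ℤ, k < 0 → h.countP (fun b => b ≤ k) = α.countP (fun b => -b ≤ k))
    (hpos : ∀ k : ℤ, 0 ≤ k → h.countP (fun b => b ≤ k) + c = π.countP (fun b => b ≤ k) + d) :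
    (α.filter (· ≠ 0)).length + (π.filter (· ≠ 0)).length ≤ h.length ∧
    h = (α.filter (· ≠ 0)).reverse.map (fun x => -x) ++
      List.replicate (h.length - (α.filter (· ≠ 0)).length - (π.filter (· ≠ 0)).length) 0 ++
      π.filter (· ≠ 0) := by
  set e := α.filter (· ≠ 0) with he
  set e' := π.filter (· ≠ 0) with he'
  have hepos : ∀ b ∈ e, 0 < b := by
    intro b hb
    have := List.mem_filter.1 hb
    have h1 := hα b this.1
    have h2 : b ≠ 0 := by simpa using this.2
    omega
  have hepos' : ∀ b ∈ e', 0 < b := by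
    intro b hb
    have := List.mem_filter.1 hb
    have h1 := hπ b this.1
    have h2 : b ≠ 0 := by simpa using this.2
    omega
  -- Negative counts only see the nonzero terms of `α`.
  have hcα : ∀ k : ℤ, k < 0 → α.countP (fun b => -b ≤ k) = e.countP (fun b => -b ≤ k) := by
    intro k hk
    rw [he, List.countP_filter]
    refine List.countP_congr fun b _ => ?_
    simp only [decide_eq_true_eq, Bool.and_eq_true, ne_eq]
    omega
  -- Nonnegative counts see all zeros of `π`.
  have hcπ : ∀ k : ℤ, 0 ≤ k →
      π.countP (fun b => b ≤ k) + e'.length = π.length + e'.countP (fun b => b ≤ k) := by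
    intro k hk
    rw [he']
    clear_value e e'
    clear hπ hπs hpos he' hepos'
    induction π with
    | nil => simp
    | cons b l ih =>
      by_cases hb : b = 0
      · simp [hb, hk] at ih ⊢
        omega
      · simp [hb, List.countP_cons] at ih ⊢
        omega
  obtain ⟨K, hK0, hK⟩ := exists_nonneg_upper_bound (h ++ π)
  have hlen : h.length + c = π.length + d := by
    have h1 := hpos K hK0
    rwa [List.countP_eq_length.2, List.countP_eq_length.2] at h1
    · intro b hb; simpa using hK b (List.mem_append_right _ hb)
    · intro b hb; simpa using hK b (List.mem_append_left _ hb)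
  have hle : e'.length ≤ π.length := List.length_filter_le _ _
  have hcount : ∀ k : ℤ, 0 ≤ k →
      h.countP (fun b => b ≤ k) + e'.length = h.length + e'.countP (fun b => b ≤ k) := by
    intro k hk
    have h1 := hpos k hk
    have h2 := hcπ k hk
    omega
  have hsum : e.length + e'.length ≤ h.length := by
    have h1 : h.countP (fun b => b ≤ -1) = e.length := by
      rw [hneg (-1) (by norm_num), hcα (-1) (by norm_num), List.countP_eq_length]
      intro b hb
      have := hepos b hb
      simp only [decide_eq_true_eq]
      omega
    have h2 : h.countP (fun b => b ≤ -1) ≤ h.countP (fun b => b ≤ 0) := by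
      refine List.countP_mono_left fun b _ hb => ?_
      simp only [decide_eq_true_eq] at hb ⊢
      omega
    have h3 : e'.countP (fun b => b ≤ 0) = 0 := by
      rw [List.countP_eq_zero]
      intro b hb
      have := hepos' b hb
      simp only [decide_eq_true_eq]
      omega
    have h4 := hcount 0 le_rfl
    omega
  refine ⟨hsum, eq_of_countP_le_eq hs ?_ fun k => ?_⟩
  · have hes : e.Pairwise (· ≤ ·) := hαs.filter _
    have hes' : e'.Pairwise (· ≤ ·) := hπs.filter _
    rw [List.pairwise_append, List.pairwise_append]
    refine ⟨⟨?_, ?_, ?_⟩, hes', ?_⟩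
    · rw [List.pairwise_map, List.pairwise_reverse]
      exact hes.imp fun hab => neg_le_neg hab
    · exact List.pairwise_replicate.2 (Or.inr le_rfl)
    · intro a ha b hb
      obtain ⟨x, hx, rfl⟩ := List.mem_map.1 ha
      rw [List.eq_of_mem_replicate hb]
      have := hepos x (List.mem_reverse.1 hx)
      omega
    · intro a ha b hb
      have hb' := hepos' b hb
      rcases List.mem_append.1 ha with ha | ha
      · obtain ⟨x, hx, rfl⟩ := List.mem_map.1 ha
        have := hepos x (List.mem_reverse.1 hx)
        omega
      · rw [List.eq_of_mem_replicate ha]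
        omega
  · rw [List.countP_append, List.countP_append, List.countP_map, List.countP_reverse,
      List.countP_replicate]
    rcases lt_or_ge k 0 with hk | hk
    · have h3 : e'.countP (fun b => b ≤ k) = 0 := by
        rw [List.countP_eq_zero]
        intro b hb
        have := hepos' b hb
        simp only [decide_eq_true_eq]
        omega
      rw [hneg k hk, hcα k hk, h3, if_neg (by simpa using hk)]
      rfl
    · have h4 : e.countP ((fun b => decide (b ≤ k)) ∘ fun x => -x) = e.length := by
        rw [List.countP_eq_length]
        intro b hb
        have := hepos b hb
        simp only [Function.comp_apply, decide_eq_true_eq]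
        omega
      have h5 := hcount k hk
      rw [h4, if_pos (by simpa using hk)]
      omega

end Main

end RationalMatrix

theorem proposition4p13 {F : Type*} [Field F] [IsAlgClosed F] {n p m s r : ℕ} (g : ℤ)
    (G : Matrix (Fin p) (Fin m) (RatFunc F)) (hr : G.rank = r)
    (L : LinearSystemMatrix F n (p + s) (m + s)) (hL : IsLinearizationAtInfty L G g)
    (ℓ : ℕ) (hℓ : ℓ = L.toSystem.degree)
    (e : List ℤ) (he : IsPartialMultiplicitiesAt (revPoly ℓ (pencil L.A₁ L.A₀)) 0 e)
    (e' : List ℤ) (he' : IsPartialMultiplicitiesAt L.toSystem.rev.toMatrix 0 e') :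
    e.length + e'.length ≤ r ∧
    ∀ q : List ℤ, IsInvariantOrdersAtInfty G q ↔
      q = (e.reverse.map (fun x => -x) ++ List.replicate (r - e.length - e'.length) 0 ++ e').map
        (fun x => x - g) := by
  subst hℓ
  obtain ⟨α, hα, rfl⟩ := he
  obtain ⟨π, hπ, rfl⟩ := he'
  obtain ⟨hmin, s₁, s₂, hrow, hcol, hequiv⟩ := hL
  set P := L.toSystem.rev with hP
  have hα' : IsInvariantOrdersAt (toRat P.A) 0 α := hα
  -- Off the zero order, `rev_g G` and the transfer function of `rev L` have the same counts.
  have hcount : ∀ k : ℤ, orderCountAt 0 k (revRat g G) + (if 0 ≤ k then s₁ else 0) =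
      orderCountAt 0 k P.transfer + if 0 ≤ k then s₂ else 0 := by
    intro k
    have hϖ0 := (irreducible_X_sub_C_localSubring (0 : F)).ne_zero
    rw [← orderCountAt_diagOne, ← orderCountAt_diagOne, hP,
      PolynomialSystemMatrix.rev_transfer, orderCountAt,
      (equivalentAt_iff_localEquiv.1 hequiv).orderCount_eq hϖ0, Matrix.reindex_apply,
      LocalSmith.orderCount_submatrix hϖ0, orderCountAt]
  obtain ⟨h, hh⟩ := exists_isInvariantOrdersAt 0 (revRat g G)
  have hhc := isInvariantOrdersAt_iff.1 hh
  have hG : IsInvariantOrdersAtInfty G (h.map fun x => x - g) := by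
    rw [isInvariantOrdersAtInfty_iff_revRat g]
    simpa [Function.comp_def] using hh
  have hlen : h.length = r := by
    rw [← hr, ← hG.2.1, List.length_map]
  obtain ⟨hsum, heq⟩ := eq_append_of_countP (c := s₁ + n) (d := s₂) hα'.nonneg hα'.1 hπ.nonneg hπ.1
    hhc.1
    (fun k hk => by
      have h1 := hcount k
      rw [if_neg (not_le.2 hk), if_neg (not_le.2 hk), add_zero, add_zero] at h1
      rw [hhc.2, h1, (P.orderCountAt_transfer hmin k).2 hk,
        hα'.orderCountAt_inv (isUnit_det_toRat P.nonsing)])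
    (fun k hk => by
      have h1 := hcount k
      rw [if_pos hk, if_pos hk] at h1
      have h2 := (P.orderCountAt_transfer hmin k).1 hk
      rw [hhc.2, (isInvariantOrdersAt_iff.1 hπ).2, h2]
      omega)
  rw [hlen] at hsum heq
  refine ⟨hsum, fun q => ?_⟩
  rw [← heq]
  constructor
  · intro hq
    rw [hh.unique ((isInvariantOrdersAtInfty_iff_revRat g G q).1 hq)]
    simp [Function.comp_def]
  · rintro rfl
    exact hG
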